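/- **One-function off-shell Kerr geometries and the Killing tower.** Let $a\in\mathbb R$, let $I\subseteq\mathbb R$ be open and let $m:I\to\mathbb R$ be any $C^2$ function. Put $\Sigma=r^2+a^2\cos^2\theta$, $\Delta=r^2+a^2-2r\,m(r)$, and consider the metric $$ds^2=-\frac{\Delta}{\Sigma}(dt-a\sin^2\theta\,d\phi)^2+\frac{\sin^2\theta}{\Sigma}\big[(r^2+a^2)\,d\phi-a\,dt\big]^2+\frac{\Sigma}{\Delta}\,dr^2+\Sigma\,d\theta^2$$ on the region $U=\{r\in I,\ 0<\theta<\pi,\ \Delta\ne0,\ \Sigma\ne0\}$ (both signs of $\Delta$ are allowed). Where $\Delta>0$ the natural co-tetrad $e^{\hat t}=\sqrt{\Delta/\Sigma}\,(-dt+a\sin^2\theta\,d\phi)$, $e^{\hat r}=\sqrt{\Sigma/\Delta}\,dr$, $e^{\hat\theta}=\sqrt\Sigma\,d\theta$, $e^{\hat\phi}=\frac{\sin\theta}{\sqrt\Sigma}\,(-a\,dt+(r^2+a^2)\,d\phi)$ is orthonormal for $\eta=\mathrm{diag}(-1,1,1,1)$. Let $$K^{\mu\nu}\partial_\mu\partial_\nu=-\frac{a^2\cos^2\theta}{\Sigma\Delta}\big[(r^2+a^2)\partial_t+a\partial_\phi\big]^2+\frac{a^2\cos^2\theta\,\Delta}{\Sigma}\,\partial_r^2-\frac{r^2}{\Sigma}\,\partial_\theta^2-\frac{r^2}{\Sigma\sin^2\theta}\big[a\sin^2\theta\,\partial_t+\partial_\phi\big]^2,$$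 $$f=a\cos\theta\,(dt-a\sin^2\theta\,d\phi)\wedge dr-r\sin\theta\,d\theta\wedge\big((r^2+a^2)\,d\phi-a\,dt\big),\qquad h=\star f .$$ 1. *Killing tensor.* Where $\Delta>0$, $K^{\hat\mu\hat\nu}=\mathrm{diag}(-a^2\cos^2\theta,\,a^2\cos^2\theta,\,-r^2,\,-r^2)$. On all of $U$, $K_{\mu\nu}$ is a Killing tensor, $K_{(\mu\nu;\alpha)}=0$. It is nontrivial: at no point of $U$ is $K^{\mu\nu}$ a linear combination of $g^{\mu\nu}$ and the symmetrized products of the Killing vectors $\partial_t,\partial_\phi$. The tensor with Boyer–Lindquist components $$P^{\mu\nu}=\frac1\Sigma\begin{bmatrix}a^2\cos^2\theta\,\frac{2r(r^2+a^2)m(r)}{\Delta}&0&0&a^2\cos^2\theta\,\frac{2ar\,m(r)}{\Delta}\\0&-a^2\cos^2\theta\,\Delta&0&0\\0&0&r^2&0\\a^2\cos^2\theta\,\frac{2ar\,m(r)}{\Delta}&0&0&\frac{a^4\cos^2\theta}{\Delta}+\frac{r^2}{\sin^2\theta}\end{bmatrix}$$ is also a Killing tensor on $U$, and $K=-\big(P+a^2\,\partial_t\partial_t+a(\partial_t\partial_\phi+\partial_\phi\partial_t)\big)$.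 2. *Killing–Yano tensor.* Where $\Delta>0$, the nonzero tetrad components of $f$ are $f^{\hat t\hat r}=-f^{\hat r\hat t}=a\cos\theta$ and $f^{\hat\phi\hat\theta}=-f^{\hat\theta\hat\phi}=r$. On $U$, $f$ is a Killing–Yano two-form, $f_{\mu(\nu;\alpha)}=0$, and it is a square root of $K$: $K^{\mu\nu}=f^{\mu\alpha}g_{\alpha\beta}f^{\beta\nu}$. 3. *Principal tensor.* On $U$, $h$ is a closed conformal Killing–Yano two-form, $\nabla_\mu h_{\nu\alpha}=\tfrac13\big(g_{\mu\nu}\nabla^\beta h_{\beta\alpha}-g_{\mu\alpha}\nabla^\beta h_{\beta\nu}\big)$. It is non-degenerate wherever $a\,r\cos\theta\neq0$, hence a principal tensor there. 4. *Commutation.* On $U$, $R^\mu{}_\alpha K^\alpha{}_\nu=K^\mu{}_\alpha R^\alpha{}_\nu$, with $R^\mu{}_\nu$ the Ricci tensor; where $\Delta>0$ the Ricci tensor is diagonal in the natural tetrad. 5. *Klein–Gordon equation.* The equation $\frac1{\sqrt{-g}}\partial_\alpha(\sqrt{-g}\,g^{\alpha\beta}\partial_\beta\Phi)=\mu^2\Phi$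 ($\mu\in\mathbb R$) separates multiplicatively: for $\omega,k\in\mathbb C$ and $C^2$ complex functions $R$ on $\{r\in I:\Delta\neq0\}$ and $S$ on $(0,\pi)$ such that $\Phi=e^{-i\omega t}e^{ik\phi}R(r)S(\theta)$ does not vanish identically on $U$, $\Phi$ solves it on $U$ if and only if for some $\lambda\in\mathbb C$ $$(\Delta R')'+\Big(\tfrac{((r^2+a^2)\omega-ak)^2}{\Delta}-\mu^2r^2-\lambda\Big)R=0,$$ $$\tfrac1{\sin\theta}(\sin\theta\,S')'+\Big(\lambda-\big(a\omega\sin\theta-\tfrac{k}{\sin\theta}\big)^2-\mu^2a^2\cos^2\theta\Big)S=0 .$$ 6. *Hamilton–Jacobi equation.* If $U\neq\varnothing$, then for $\mu,E,L\in\mathbb R$ and differentiable real functions $W$ on $\{r\in I:\Delta\ne0\}$ and $V$ on $(0,\pi)$, $\mathcal S=-Et+L\phi+W(r)+V(\theta)$ satisfies $g^{\mu\nu}\partial_\mu\mathcal S\,\partial_\nu\mathcal S=-\mu^2$ on $U$ if and only if for some $C\in\mathbb R$ $$\Delta\,W'^2-\tfrac{((r^2+a^2)E-aL)^2}{\Delta}+\mu^2r^2=-C,\qquad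 V'^2+\big(aE\sin\theta-\tfrac{L}{\sin\theta}\big)^2+\mu^2a^2\cos^2\theta=C .$$ In particular all of this holds for the eye-of-the-storm metric, $m(r)=M e^{-\ell/r}$ on $r>0$, for all real $M$ and $\ell$. -/

import Mathlib

open scoped Matrix

noncomputable section

/-! ## Pseudo-Riemannian geometry in a four-dimensional coordinate chart -/

/-- A point of the chart, with coordinates `(x 0, x 1, x 2, x 3) = (t, r, θ, φ)`. -/
abbrev Coord : Type := Fin 4 → ℝ

/-- The components of a two-index object at one point. -/
abbrev Mat4 : Type := Matrix (Fin 4) (Fin 4) ℝ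

/-- The partial derivative `∂_μ F` at `x`. -/
def pderiv {E : Type*} [NormedAddCommGroup E] [NormedSpace ℝ E]
    (μ : Fin 4) (F : Coord → E) (x : Coord) : E :=
  deriv (fun s : ℝ => F (Function.update x μ s)) (x μ)

/-- The Christoffel symbol `Γ^μ_{αβ}` of the metric `g` at `x`. -/
def christoffel (g : Coord → Mat4) (x : Coord) (μ α β : Fin 4) : ℝ :=
  (1 / 2) * ∑ ν, (g x)⁻¹ μ ν *
    (pderiv α (fun y => g y ν β) x + pderiv β (fun y => g y ν α) x
      - pderiv ν (fun y => g y α β) x)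

/-- The Riemann tensor `R^μ_{ναβ}`. -/
def riemann (g : Coord → Mat4) (x : Coord) (μ ν α β : Fin 4) : ℝ :=
  pderiv α (fun y => christoffel g y μ ν β) x - pderiv β (fun y => christoffel g y μ ν α) x
    + ∑ σ, (christoffel g x μ σ α * christoffel g x σ ν β
        - christoffel g x μ σ β * christoffel g x σ ν α)

/-- The Ricci tensor `R_{μν} = R^σ_{μσν}`. -/
def ricci (g : Coord → Mat4) (x : Coord) : Mat4 :=
  Matrix.of fun μ ν => ∑ σ, riemann g x σ μ σ ν

/-- The covariant derivative `∇_α T_{μν}` of a covariant two-index tensor field. -/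
def covDeriv (g T : Coord → Mat4) (x : Coord) (α μ ν : Fin 4) : ℝ :=
  pderiv α (fun y => T y μ ν) x
    - ∑ σ, (christoffel g x σ α μ * T x σ ν + christoffel g x σ α ν * T x μ σ)

/-- Lowering both indices: `T_{μν} = g_{μα} T^{αβ} g_{βν}`. -/
def lowerIdx (g T : Coord → Mat4) (x : Coord) : Mat4 := g x * T x * g x

/-- Raising both indices: `T^{μν} = g^{μα} T_{αβ} g^{βν}`. -/
def raiseIdx (g T : Coord → Mat4) (x : Coord) : Mat4 := (g x)⁻¹ * T x * (g x)⁻¹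

/-- The Levi-Civita symbol: the sign of `(μ, ν, α, β)` if this is a permutation of
`(0, 1, 2, 3)`, and zero if an index is repeated. -/
def leviCivita (μ ν α β : Fin 4) : ℝ :=
  Matrix.det (Matrix.of fun i j : Fin 4 => if ![μ, ν, α, β] i = j then (1 : ℝ) else 0)

/-- The Hodge dual `(⋆f)_{μν} = ½ √|det g| ε_{μναβ} f^{αβ}` of a two-form `f_{μν}`. -/
def hodgeDual (g f : Coord → Mat4) (x : Coord) : Mat4 :=
  Matrix.of fun μ ν =>
    (1 / 2) * Real.sqrt |(g x).det| * ∑ α, ∑ β, leviCivita μ ν α β * raiseIdx g f x α β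

/-- `K_{μν}` is a Killing tensor on `U`: a symmetric `C¹` tensor field with
`K_{(μν;α)} = 0`. -/
structure IsKillingTensor (g : Coord → Mat4) (U : Set Coord) (K : Coord → Mat4) : Prop where
  contDiffOn : ∀ μ ν, ContDiffOn ℝ 1 (fun x => K x μ ν) U
  symm : ∀ x ∈ U, ∀ μ ν, K x μ ν = K x ν μ
  killing : ∀ x ∈ U, ∀ μ ν α,
    covDeriv g K x α μ ν + covDeriv g K x μ ν α + covDeriv g K x ν α μ = 0

/-- `f_{μν}` is a Killing–Yano two-form on `U`: `f_{μ(ν;α)} = 0`. -/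
structure IsKillingYano (g : Coord → Mat4) (U : Set Coord) (f : Coord → Mat4) : Prop where
  contDiffOn : ∀ μ ν, ContDiffOn ℝ 1 (fun x => f x μ ν) U
  antisymm : ∀ x ∈ U, ∀ μ ν, f x μ ν = -f x ν μ
  killingYano : ∀ x ∈ U, ∀ μ ν α, covDeriv g f x α μ ν + covDeriv g f x ν μ α = 0

/-- The divergence `∇^β h_{βα}`. -/
def divergence (g h : Coord → Mat4) (x : Coord) (α : Fin 4) : ℝ :=
  ∑ β, ∑ γ, (g x)⁻¹ β γ * covDeriv g h x γ β α

/-- `h_{μν}` is a closed conformal Killing–Yano two-form on `U`: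
`∇_μ h_{να} = ⅓ (g_{μν} ∇^β h_{βα} - g_{μα} ∇^β h_{βν})`. -/
structure IsClosedConformalKillingYano (g : Coord → Mat4) (U : Set Coord)
    (h : Coord → Mat4) : Prop where
  contDiffOn : ∀ μ ν, ContDiffOn ℝ 1 (fun x => h x μ ν) U
  antisymm : ∀ x ∈ U, ∀ μ ν, h x μ ν = -h x ν μ
  conformal : ∀ x ∈ U, ∀ μ ν α, covDeriv g h x μ ν α =
    (1 / 3) * (g x μ ν * divergence g h x α - g x μ α * divergence g h x ν)

/-- A principal tensor on `U`: a closed conformal Killing–Yano two-form that is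
non-degenerate at every point of `U`. -/
structure IsPrincipalTensor (g : Coord → Mat4) (U : Set Coord) (h : Coord → Mat4) : Prop where
  closedConformal : IsClosedConformalKillingYano g U h
  nondegenerate : ∀ x ∈ U, (h x).det ≠ 0

/-- The scalar wave operator `□Φ = (1/√-g) ∂_α (√-g g^{αβ} ∂_β Φ)`, for Lorentzian `g`. -/
def waveOp (g : Coord → Mat4) (Φ : Coord → ℂ) (x : Coord) : ℂ :=
  (1 / Real.sqrt (-(g x).det)) •
    ∑ α, pderiv α (fun y => ∑ β, (Real.sqrt (-(g y).det) * (g y)⁻¹ α β) • pderiv β Φ y) x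

/-! ## The one-function off-shell Kerr geometries -/

/-- `Σ = r² + a² cos² θ`. -/
def kerrSigma (a : ℝ) (x : Coord) : ℝ := x 1 ^ 2 + a ^ 2 * Real.cos (x 2) ^ 2

/-- `Δ(r) = r² + a² - 2 r m(r)`. -/
def kerrDelta (a : ℝ) (m : ℝ → ℝ) (r : ℝ) : ℝ := r ^ 2 + a ^ 2 - 2 * r * m r

/-- The radii in `I` (where the mass function lives) with `Δ(r) ≠ 0`. -/
def radialDomain (a : ℝ) (m : ℝ → ℝ) (I : Set ℝ) : Set ℝ := {r | r ∈ I ∧ kerrDelta a m r ≠ 0}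

/-- The part of Boyer–Lindquist coordinate space on which the line element is regular:
`r ∈ I`, `0 < θ < π`, `Σ ≠ 0`, `Δ ≠ 0`. Both signs of `Δ` are allowed. -/
def kerrRegion (a : ℝ) (m : ℝ → ℝ) (I : Set ℝ) : Set Coord :=
  {x | x 1 ∈ radialDomain a m I ∧ x 2 ∈ Set.Ioo 0 Real.pi ∧ kerrSigma a x ≠ 0}

/-- The metric `ds² = -(Δ/Σ)(dt - a sin²θ dφ)² + (sin²θ/Σ)((r² + a²) dφ - a dt)²
+ (Σ/Δ) dr² + Σ dθ²`. -/
def kerrMetric (a : ℝ) (m : ℝ → ℝ) (x : Coord) : Mat4 :=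
  (-(kerrDelta a m (x 1) / kerrSigma a x)) •
      Matrix.vecMulVec ![1, 0, 0, -(a * Real.sin (x 2) ^ 2)] ![1, 0, 0, -(a * Real.sin (x 2) ^ 2)]
    + (Real.sin (x 2) ^ 2 / kerrSigma a x) •
      Matrix.vecMulVec ![-a, 0, 0, x 1 ^ 2 + a ^ 2] ![-a, 0, 0, x 1 ^ 2 + a ^ 2]
    + Matrix.diagonal ![0, kerrSigma a x / kerrDelta a m (x 1), kerrSigma a x, 0]

/-- The Minkowski metric `η`. -/
def minkowski : Mat4 := Matrix.diagonal ![-1, 1, 1, 1]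

/-- The natural co-tetrad, where `Δ > 0`; row `μ̂` is the covector `e^{μ̂}`. -/
def kerrCotetrad (a : ℝ) (m : ℝ → ℝ) (x : Coord) : Mat4 :=
  Matrix.of ![
    Real.sqrt (kerrDelta a m (x 1) / kerrSigma a x) • ![-1, 0, 0, a * Real.sin (x 2) ^ 2],
    Real.sqrt (kerrSigma a x / kerrDelta a m (x 1)) • ![0, 1, 0, 0],
    Real.sqrt (kerrSigma a x) • ![0, 0, 1, 0],
    (Real.sin (x 2) / Real.sqrt (kerrSigma a x)) • ![-a, 0, 0, x 1 ^ 2 + a ^ 2]]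

/-- Tetrad components `T^{μ̂ν̂} = e^{μ̂}_μ e^{ν̂}_ν T^{μν}` of a contravariant tensor field. -/
def tetradComponents (a : ℝ) (m : ℝ → ℝ) (T : Coord → Mat4) (x : Coord) : Mat4 :=
  kerrCotetrad a m x * T x * (kerrCotetrad a m x)ᵀ

/-- The contravariant tensor `K^{μν} = -a²cos²θ e_t̂ e_t̂ + a²cos²θ e_r̂ e_r̂ - r² e_θ̂ e_θ̂
- r² e_φ̂ e_φ̂`, where `e_t̂ = -(ΣΔ)^{-1/2} ((r²+a²) ∂_t + a ∂_φ)`, `e_r̂ = (Δ/Σ)^{1/2} ∂_r`,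
`e_θ̂ = Σ^{-1/2} ∂_θ` and `e_φ̂ = Σ^{-1/2} (a sin θ ∂_t + ∂_φ / sin θ)`. Written out, the square
roots disappear, and the formula also makes sense where `Δ < 0`. -/
def kerrKillingUp (a : ℝ) (m : ℝ → ℝ) (x : Coord) : Mat4 :=
  (-(a ^ 2 * Real.cos (x 2) ^ 2) / (kerrSigma a x * kerrDelta a m (x 1))) •
      Matrix.vecMulVec ![x 1 ^ 2 + a ^ 2, 0, 0, a] ![x 1 ^ 2 + a ^ 2, 0, 0, a]
    + Matrix.diagonal
      ![0, a ^ 2 * Real.cos (x 2) ^ 2 * kerrDelta a m (x 1) / kerrSigma a x,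
        -(x 1 ^ 2) / kerrSigma a x, 0]
    + (-(x 1 ^ 2) / (kerrSigma a x * Real.sin (x 2) ^ 2)) •
      Matrix.vecMulVec ![a * Real.sin (x 2) ^ 2, 0, 0, 1] ![a * Real.sin (x 2) ^ 2, 0, 0, 1]

/-- The contravariant tensor produced in Boyer–Lindquist coordinates by the
Papadopoulos–Kokkotas algorithm. -/
def kerrKillingPK (a : ℝ) (m : ℝ → ℝ) (x : Coord) : Mat4 :=
  let r := x 1
  let s := Real.sin (x 2)
  let A := a ^ 2 * Real.cos (x 2) ^ 2
  let Δ := kerrDelta a m r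
  (1 / kerrSigma a x) •
    !![A * (2 * r * (r ^ 2 + a ^ 2) * m r / Δ), 0, 0, A * (2 * a * r * m r / Δ);
       0, -(A * Δ), 0, 0;
       0, 0, r ^ 2, 0;
       A * (2 * a * r * m r / Δ), 0, 0, A * a ^ 2 / Δ + r ^ 2 / s ^ 2]

/-- The two-form `f = a cos θ (dt - a sin²θ dφ) ∧ dr - r sin θ dθ ∧ ((r² + a²) dφ - a dt)`,
as the antisymmetric matrix `f_{μν}`. -/
def kerrYano (a : ℝ) (x : Coord) : Mat4 :=
  let r := x 1
  let s := Real.sin (x 2)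
  let c := Real.cos (x 2)
  !![0, a * c, -(a * r * s), 0;
     -(a * c), 0, 0, a ^ 2 * c * s ^ 2;
     a * r * s, 0, 0, -(r * s * (r ^ 2 + a ^ 2));
     0, -(a ^ 2 * c * s ^ 2), r * s * (r ^ 2 + a ^ 2), 0]

/-- The contravariant components `f^{μν}`. -/
def kerrYanoUp (a : ℝ) (m : ℝ → ℝ) : Coord → Mat4 := raiseIdx (kerrMetric a m) (kerrYano a)

/-- The Hodge dual `h = ⋆f`. -/
def kerrPrincipal (a : ℝ) (m : ℝ → ℝ) : Coord → Mat4 := hodgeDual (kerrMetric a m) (kerrYano a)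

/-- The eye-of-the-storm mass function `m(r) = M exp(-ℓ/r)`, used for `r > 0`. -/
def eosMass (M ℓ : ℝ) (r : ℝ) : ℝ := M * Real.exp (-ℓ / r)

/-! ## The properties asserted of these geometries -/

/-- The full Killing tower of the geometry with mass function `m` on `I`: Killing tensor,
Killing–Yano two-form and principal tensor, with their relations and tetrad components. -/
structure HasKillingTower (a : ℝ) (m : ℝ → ℝ) (I : Set ℝ) : Prop where
  /-- The natural co-tetrad is orthonormal. -/
  tetrad_orthonormal : ∀ x ∈ kerrRegion a m I, 0 < kerrDelta a m (x 1) →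
    (kerrCotetrad a m x)ᵀ * minkowski * kerrCotetrad a m x = kerrMetric a m x
  /-- Tetrad components of the Killing tensor. -/
  killing_tetrad : ∀ x ∈ kerrRegion a m I, 0 < kerrDelta a m (x 1) →
    tetradComponents a m (kerrKillingUp a m) x =
      Matrix.diagonal ![-(a ^ 2 * Real.cos (x 2) ^ 2), a ^ 2 * Real.cos (x 2) ^ 2,
        -(x 1 ^ 2), -(x 1 ^ 2)]
  killing : IsKillingTensor (kerrMetric a m) (kerrRegion a m I)
    (lowerIdx (kerrMetric a m) (kerrKillingUp a m))
  /-- The Killing tensor is nontrivial: at no point is it a linear combination of the inverse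
  metric and the symmetrized products of the Killing vectors `∂_t`, `∂_φ`. -/
  killing_nontrivial : ∀ x ∈ kerrRegion a m I, ¬ ∃ c₀ c₁ c₂ c₃ : ℝ,
    kerrKillingUp a m x =
      c₀ • (kerrMetric a m x)⁻¹ + !![c₁, 0, 0, c₂; 0, 0, 0, 0; 0, 0, 0, 0; c₂, 0, 0, c₃]
  /-- The Papadopoulos–Kokkotas tensor is a Killing tensor, and differs from `-K` only by
  products of the Killing vectors `∂_t`, `∂_φ`. -/
  killingPK : IsKillingTensor (kerrMetric a m) (kerrRegion a m I)
    (lowerIdx (kerrMetric a m) (kerrKillingPK a m))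
  killingPK_eq : ∀ x ∈ kerrRegion a m I,
    kerrKillingUp a m x = -(kerrKillingPK a m x
      + !![a ^ 2, 0, 0, a; 0, 0, 0, 0; 0, 0, 0, 0; a, 0, 0, 0])
  /-- Tetrad components of the Killing–Yano two-form. -/
  yano_tetrad : ∀ x ∈ kerrRegion a m I, 0 < kerrDelta a m (x 1) →
    tetradComponents a m (kerrYanoUp a m) x =
      !![0, a * Real.cos (x 2), 0, 0;
         -(a * Real.cos (x 2)), 0, 0, 0;
         0, 0, 0, -(x 1);
         0, 0, x 1, 0]
  yano : IsKillingYano (kerrMetric a m) (kerrRegion a m I) (kerrYano a)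
  /-- `f` is a square root of `K`: `K^{μν} = f^{μα} g_{αβ} f^{βν}`. -/
  yano_sq : ∀ x ∈ kerrRegion a m I,
    kerrKillingUp a m x = kerrYanoUp a m x * kerrMetric a m x * kerrYanoUp a m x
  /-- `h = ⋆f` is closed conformal Killing–Yano everywhere. -/
  closedConformal : IsClosedConformalKillingYano (kerrMetric a m) (kerrRegion a m I)
    (kerrPrincipal a m)
  /-- `h` is a principal tensor away from the degeneracy locus `a r cos θ = 0`. -/
  principal : IsPrincipalTensor (kerrMetric a m)
    {x | x ∈ kerrRegion a m I ∧ a * x 1 * Real.cos (x 2) ≠ 0} (kerrPrincipal a m)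

/-- The Ricci and Killing tensors commute as endomorphisms, `R^μ_α K^α_ν = K^μ_α R^α_ν`, and
the Ricci tensor is diagonal in the natural tetrad. -/
structure RicciKillingCommute (a : ℝ) (m : ℝ → ℝ) (I : Set ℝ) : Prop where
  commute : ∀ x ∈ kerrRegion a m I,
    Commute ((kerrMetric a m x)⁻¹ * ricci (kerrMetric a m) x)
      (kerrKillingUp a m x * kerrMetric a m x)
  ricci_diag : ∀ x ∈ kerrRegion a m I, 0 < kerrDelta a m (x 1) →
    (tetradComponents a m (raiseIdx (kerrMetric a m) (ricci (kerrMetric a m))) x).IsDiag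

/-- The mode `Φ = e^{-iωt} e^{ikφ} R(r) S(θ)`. -/
def separatedMode (ω k : ℂ) (R S : ℝ → ℂ) (x : Coord) : ℂ :=
  Complex.exp (-(Complex.I * ω * (x 0 : ℂ))) * Complex.exp (Complex.I * k * (x 3 : ℂ))
    * R (x 1) * S (x 2)

/-- Radial equation
`(Δ R')' + ((((r² + a²) ω - a k)²) / Δ - μ² r² - Λ) R = 0`, with separation constant `Λ`. -/
def RadialEquation (a : ℝ) (m : ℝ → ℝ) (I : Set ℝ) (μ : ℝ) (ω k Λ : ℂ) (R : ℝ → ℂ) : Prop :=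
  ∀ r ∈ radialDomain a m I,
    deriv (fun s : ℝ => (kerrDelta a m s : ℂ) * deriv R s) r
      + ((((r ^ 2 + a ^ 2 : ℝ) : ℂ) * ω - (a : ℂ) * k) ^ 2 / (kerrDelta a m r : ℂ)
          - ((μ ^ 2 * r ^ 2 : ℝ) : ℂ) - Λ) * R r = 0

/-- Angular equation
`(sin θ S')' / sin θ + (Λ - (a ω sin θ - k / sin θ)² - μ² a² cos² θ) S = 0`. -/
def AngularEquation (a μ : ℝ) (ω k Λ : ℂ) (S : ℝ → ℂ) : Prop :=
  ∀ θ ∈ Set.Ioo 0 Real.pi,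
    deriv (fun s : ℝ => (Real.sin s : ℂ) * deriv S s) θ / (Real.sin θ : ℂ)
      + (Λ - ((a : ℂ) * ω * (Real.sin θ : ℂ) - k / (Real.sin θ : ℂ)) ^ 2
          - ((μ ^ 2 * a ^ 2 * Real.cos θ ^ 2 : ℝ) : ℂ)) * S θ = 0

/-- Multiplicative separability of the (massive or massless) Klein–Gordon equation
`□Φ = μ²Φ`: a mode that is not identically zero solves it if and only if its radial and angular
factors solve the two ordinary differential equations with a common separation constant. -/
def KleinGordonSeparates (a : ℝ) (m : ℝ → ℝ) (I : Set ℝ) : Prop :=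
  ∀ (μ : ℝ) (ω k : ℂ) (R S : ℝ → ℂ),
    ContDiffOn ℝ 2 R (radialDomain a m I) → ContDiffOn ℝ 2 S (Set.Ioo 0 Real.pi) →
    (∃ x ∈ kerrRegion a m I, separatedMode ω k R S x ≠ 0) →
    ((∀ x ∈ kerrRegion a m I,
        waveOp (kerrMetric a m) (separatedMode ω k R S) x
          = ((μ ^ 2 : ℝ) : ℂ) * separatedMode ω k R S x) ↔
      ∃ Λ : ℂ, RadialEquation a m I μ ω k Λ R ∧ AngularEquation a μ ω k Λ S)

/-- Additive separability of the Hamilton–Jacobi equation `g^{μν} ∂_μ 𝒮 ∂_ν 𝒮 = -μ²`: the ansatz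
`𝒮 = -E t + L φ + W(r) + V(θ)` solves it if and only if `W` and `V` solve the separated equations
with a common separation constant `C`. -/
def HamiltonJacobiSeparates (a : ℝ) (m : ℝ → ℝ) (I : Set ℝ) : Prop :=
  (kerrRegion a m I).Nonempty →
  ∀ (μ E L : ℝ) (W V : ℝ → ℝ),
    DifferentiableOn ℝ W (radialDomain a m I) → DifferentiableOn ℝ V (Set.Ioo 0 Real.pi) →
    ((∀ x ∈ kerrRegion a m I,
        ∑ α, ∑ β, (kerrMetric a m x)⁻¹ α β
            * pderiv α (fun y => -E * y 0 + L * y 3 + W (y 1) + V (y 2)) x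
            * pderiv β (fun y => -E * y 0 + L * y 3 + W (y 1) + V (y 2)) x = -μ ^ 2) ↔
      ∃ C : ℝ,
        (∀ r ∈ radialDomain a m I,
          kerrDelta a m r * deriv W r ^ 2
            - ((r ^ 2 + a ^ 2) * E - a * L) ^ 2 / kerrDelta a m r + μ ^ 2 * r ^ 2 = -C) ∧
        (∀ θ ∈ Set.Ioo 0 Real.pi,
          deriv V θ ^ 2 + (a * E * Real.sin θ - L / Real.sin θ) ^ 2
            + μ ^ 2 * a ^ 2 * Real.cos θ ^ 2 = C))

end

/-! Every component in play is a rational expression in `r`, `sin θ`, `cos θ`, `Δ`, `Δ'` and the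
inverses of `Σ`, `Δ`, `sin θ`. These expressions are closed under `∂_r` and `∂_θ`, apart from `∂_r
Δ' = Δ''`. So each tensor identity becomes an algebraic one in which `Δ`, `Δ'`, `Δ''` are
independent variables, and the only relations needed are `sin² + cos² = 1` and those defining `Σ`
and the inverses. This is why the mass function is arbitrary. `KerrExpr` is the syntax of such
expressions, and `pderiv_eq_evalPd` says that its formal derivatives are the true ones.

Let `q` be the block `-(Δ/Σ)(dt - a sin²θ dφ)² + (Σ/Δ) dr²` of the metric (`radialForm`), and let
`ξ` be `∂_t` with lowered index. The geometry is carried by four formulas: - `K = Σ q - r² g`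
(`killing`), with `K = f g⁻¹ f` (`yano_mul_inverseMetric_mul_yano`); - `∇f` is minus the contraction
of the volume form with `∂_t`, hence totally antisymmetric (`evalCov_yano`); - `∇_μ h_{να} = g_{μα}
ξ_ν - g_{μν} ξ_α` (`evalCov_principal`), whose trace is `-3 ξ`; - `Ric = b g + c q` with scalar
functions `b`, `c` (`ricci_algebraic`). Hence `g⁻¹ Ric` and `g⁻¹ K` are both combinations of `1` and
`g⁻¹ q`, so they commute, and they are diagonal in the tetrad.

Both wave equations separate because `Σ g^{αβ}` is a function of `r` plus a function of `θ`, and so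
is `Σ` itself in the mass term (`inverse_weight`, `waveOp_separatedMode`, `hamiltonJacobi_sum`). The
separation constant comes from freezing one variable at a base point. The region can miss the ring
`r = 0`, `θ = π/2` and so need not be a product; the base points are therefore taken off `r = 0` and
`θ = π/2`. -/

open scoped Matrix Topology

noncomputable section

/-! ## Rational expressions in the Boyer–Lindquist structure functions -/

/-- The values at one point of the functions from which all components are built:
`r`, `sin θ`, `cos θ`, `Δ`, `Δ'`, `Σ⁻¹`, `Δ⁻¹`, `(sin θ)⁻¹` and the parameter `a`. -/
structure KerrEnv where
  a : ℝ
  r : ℝ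
  s : ℝ
  c : ℝ
  D : ℝ
  D₁ : ℝ
  iS : ℝ
  iD : ℝ
  is : ℝ

/-- Formal rational expressions in the structure functions. -/
inductive KerrExpr : Type
  | num (n : ℚ) | a | r | s | c | D | D₁ | iS | iD | is
  | add (e f : KerrExpr) | neg (e : KerrExpr) | mul (e f : KerrExpr) | pow (e : KerrExpr) (n : ℕ)

namespace KerrExpr

instance : Add KerrExpr := ⟨add⟩
instance : Neg KerrExpr := ⟨neg⟩
instance : Sub KerrExpr := ⟨fun e f => add e (neg f)⟩
instance : Mul KerrExpr := ⟨mul⟩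
instance : Pow KerrExpr ℕ := ⟨pow⟩
instance : Zero KerrExpr := ⟨num 0⟩
instance : One KerrExpr := ⟨num 1⟩

/-- The value of an expression. -/
def eval (p : KerrEnv) : KerrExpr → ℝ
  | num n => n
  | a => p.a
  | r => p.r
  | s => p.s
  | c => p.c
  | D => p.D
  | D₁ => p.D₁
  | iS => p.iS
  | iD => p.iD
  | is => p.is
  | add e f => eval p e + eval p f
  | neg e => -eval p e
  | mul e f => eval p e * eval p f
  | pow e n => eval p e ^ n

/-- The value of the `r`-derivative of an expression, given the value `D₂` of `Δ''`. -/
def evalDr (D₂ : ℝ) (p : KerrEnv) : KerrExpr → ℝ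
  | num _ => 0
  | a => 0
  | r => 1
  | s => 0
  | c => 0
  | D => p.D₁
  | D₁ => D₂
  | iS => -(2 * p.r * p.iS ^ 2)
  | iD => -(p.D₁ * p.iD ^ 2)
  | is => 0
  | add e f => evalDr D₂ p e + evalDr D₂ p f
  | neg e => -evalDr D₂ p e
  | mul e f => evalDr D₂ p e * eval p f + eval p e * evalDr D₂ p f
  | pow e n => n * eval p e ^ (n - 1) * evalDr D₂ p e

/-- The value of the `θ`-derivative of an expression. -/
def evalDθ (p : KerrEnv) : KerrExpr → ℝ
  | num _ => 0
  | a => 0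
  | r => 0
  | s => p.c
  | c => -p.s
  | D => 0
  | D₁ => 0
  | iS => 2 * p.a ^ 2 * p.s * p.c * p.iS ^ 2
  | iD => 0
  | is => -(p.c * p.is ^ 2)
  | add e f => evalDθ p e + evalDθ p f
  | neg e => -evalDθ p e
  | mul e f => evalDθ p e * eval p f + eval p e * evalDθ p f
  | pow e n => n * eval p e ^ (n - 1) * evalDθ p e

/-- The value of the partial derivative `∂_α` of an expression. -/
def evalPd (D₂ : ℝ) (p : KerrEnv) (α : Fin 4) (e : KerrExpr) : ℝ :=
  ![0, evalDr D₂ p e, evalDθ p e, 0] α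

section simps

variable (D₂ : ℝ) (p : KerrEnv) (e f : KerrExpr) (n : ℕ)

@[simp] theorem eval_zero : eval p 0 = 0 := Rat.cast_zero
@[simp] theorem eval_one : eval p 1 = 1 := Rat.cast_one
@[simp] theorem eval_num (k : ℚ) : eval p (num k) = k := rfl
@[simp] theorem eval_a : eval p a = p.a := rfl
@[simp] theorem eval_r : eval p r = p.r := rfl
@[simp] theorem eval_s : eval p s = p.s := rfl
@[simp] theorem eval_c : eval p c = p.c := rfl
@[simp] theorem eval_D : eval p D = p.D := rfl
@[simp] theorem eval_D₁ : eval p D₁ = p.D₁ := rfl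
@[simp] theorem eval_iS : eval p iS = p.iS := rfl
@[simp] theorem eval_iD : eval p iD = p.iD := rfl
@[simp] theorem eval_is : eval p is = p.is := rfl
@[simp] theorem eval_add : eval p (e + f) = eval p e + eval p f := rfl
@[simp] theorem eval_neg : eval p (-e) = -eval p e := rfl
@[simp] theorem eval_sub : eval p (e - f) = eval p e - eval p f := (sub_eq_add_neg _ _).symm
@[simp] theorem eval_mul : eval p (e * f) = eval p e * eval p f := rfl
@[simp] theorem eval_pow : eval p (e ^ n) = eval p e ^ n := rfl

@[simp] theorem evalDr_zero : evalDr D₂ p 0 = 0 := rfl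
@[simp] theorem evalDr_one : evalDr D₂ p 1 = 0 := rfl
@[simp] theorem evalDr_num (k : ℚ) : evalDr D₂ p (num k) = 0 := rfl
@[simp] theorem evalDr_a : evalDr D₂ p a = 0 := rfl
@[simp] theorem evalDr_r : evalDr D₂ p r = 1 := rfl
@[simp] theorem evalDr_s : evalDr D₂ p s = 0 := rfl
@[simp] theorem evalDr_c : evalDr D₂ p c = 0 := rfl
@[simp] theorem evalDr_D : evalDr D₂ p D = p.D₁ := rfl
@[simp] theorem evalDr_D₁ : evalDr D₂ p D₁ = D₂ := rfl
@[simp] theorem evalDr_iS : evalDr D₂ p iS = -(2 * p.r * p.iS ^ 2) := rfl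
@[simp] theorem evalDr_iD : evalDr D₂ p iD = -(p.D₁ * p.iD ^ 2) := rfl
@[simp] theorem evalDr_is : evalDr D₂ p is = 0 := rfl
@[simp] theorem evalDr_add : evalDr D₂ p (e + f) = evalDr D₂ p e + evalDr D₂ p f := rfl
@[simp] theorem evalDr_neg : evalDr D₂ p (-e) = -evalDr D₂ p e := rfl
@[simp] theorem evalDr_sub : evalDr D₂ p (e - f) = evalDr D₂ p e - evalDr D₂ p f :=
  (sub_eq_add_neg _ _).symm
@[simp] theorem evalDr_mul :
    evalDr D₂ p (e * f) = evalDr D₂ p e * eval p f + eval p e * evalDr D₂ p f := rfl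
@[simp] theorem evalDr_pow :
    evalDr D₂ p (e ^ n) = n * eval p e ^ (n - 1) * evalDr D₂ p e := rfl

@[simp] theorem evalDθ_zero : evalDθ p 0 = 0 := rfl
@[simp] theorem evalDθ_one : evalDθ p 1 = 0 := rfl
@[simp] theorem evalDθ_num (k : ℚ) : evalDθ p (num k) = 0 := rfl
@[simp] theorem evalDθ_a : evalDθ p a = 0 := rfl
@[simp] theorem evalDθ_r : evalDθ p r = 0 := rfl
@[simp] theorem evalDθ_s : evalDθ p s = p.c := rfl
@[simp] theorem evalDθ_c : evalDθ p c = -p.s := rfl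
@[simp] theorem evalDθ_D : evalDθ p D = 0 := rfl
@[simp] theorem evalDθ_D₁ : evalDθ p D₁ = 0 := rfl
@[simp] theorem evalDθ_iS : evalDθ p iS = 2 * p.a ^ 2 * p.s * p.c * p.iS ^ 2 := rfl
@[simp] theorem evalDθ_iD : evalDθ p iD = 0 := rfl
@[simp] theorem evalDθ_is : evalDθ p is = -(p.c * p.is ^ 2) := rfl
@[simp] theorem evalDθ_add : evalDθ p (e + f) = evalDθ p e + evalDθ p f := rfl
@[simp] theorem evalDθ_neg : evalDθ p (-e) = -evalDθ p e := rfl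
@[simp] theorem evalDθ_sub : evalDθ p (e - f) = evalDθ p e - evalDθ p f :=
  (sub_eq_add_neg _ _).symm
@[simp] theorem evalDθ_mul :
    evalDθ p (e * f) = evalDθ p e * eval p f + eval p e * evalDθ p f := rfl
@[simp] theorem evalDθ_pow :
    evalDθ p (e ^ n) = n * eval p e ^ (n - 1) * evalDθ p e := rfl

@[simp] theorem evalPd_t : evalPd D₂ p 0 e = 0 := rfl
@[simp] theorem evalPd_r : evalPd D₂ p 1 e = evalDr D₂ p e := rfl
@[simp] theorem evalPd_θ : evalPd D₂ p 2 e = evalDθ p e := rfl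
@[simp] theorem evalPd_φ : evalPd D₂ p 3 e = 0 := rfl

end simps

end KerrExpr

/-! ## The region -/

/-- The structure functions at a point of the chart. -/
def kerrEnv (a : ℝ) (m : ℝ → ℝ) (x : Coord) : KerrEnv where
  a := a
  r := x 1
  s := Real.sin (x 2)
  c := Real.cos (x 2)
  D := kerrDelta a m (x 1)
  D₁ := deriv (kerrDelta a m) (x 1)
  iS := (kerrSigma a x)⁻¹
  iD := (kerrDelta a m (x 1))⁻¹
  is := (Real.sin (x 2))⁻¹

/-- The algebraic relations between the structure functions on the region. -/
structure KerrEnv.Valid (p : KerrEnv) : Prop where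
  sq_add_sq : p.s ^ 2 + p.c ^ 2 = 1
  sigma_ne : p.r ^ 2 + p.a ^ 2 * p.c ^ 2 ≠ 0
  D_ne : p.D ≠ 0
  s_ne : p.s ≠ 0
  iS_eq : p.iS = (p.r ^ 2 + p.a ^ 2 * p.c ^ 2)⁻¹
  iD_eq : p.iD = p.D⁻¹
  is_eq : p.is = p.s⁻¹

section

variable {a : ℝ} {m : ℝ → ℝ} {I : Set ℝ} {x : Coord}

theorem kerrEnv_valid (hx : x ∈ kerrRegion a m I) : (kerrEnv a m x).Valid where
  sq_add_sq := Real.sin_sq_add_cos_sq _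
  sigma_ne := hx.2.2
  D_ne := hx.1.2
  s_ne := (Real.sin_pos_of_mem_Ioo hx.2.1).ne'
  iS_eq := rfl
  iD_eq := rfl
  is_eq := rfl

theorem sin_pos_of_mem_kerrRegion (hx : x ∈ kerrRegion a m I) : 0 < Real.sin (x 2) :=
  Real.sin_pos_of_mem_Ioo hx.2.1

theorem kerrSigma_pos (hx : x ∈ kerrRegion a m I) : 0 < kerrSigma a x :=
  lt_of_le_of_ne (by unfold kerrSigma; positivity) (Ne.symm hx.2.2)

theorem continuousOn_kerrDelta (hm : ContinuousOn m I) : ContinuousOn (kerrDelta a m) I := by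
  unfold kerrDelta
  fun_prop

theorem isOpen_radialDomain (hI : IsOpen I) (hm : ContinuousOn m I) :
    IsOpen (radialDomain a m I) :=
  (continuousOn_kerrDelta hm).isOpen_inter_preimage hI isOpen_ne

theorem isOpen_kerrRegion (hI : IsOpen I) (hm : ContinuousOn m I) :
    IsOpen (kerrRegion a m I) := by
  refine ((isOpen_radialDomain hI hm).preimage
    (f := fun x : Coord => x 1) (continuous_apply 1)).inter
    ((isOpen_Ioo.preimage (f := fun x : Coord => x 2) (continuous_apply 2)).inter
      (isOpen_ne.preimage ?_))
  unfold kerrSigma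
  fun_prop

/-! ## Partial derivatives of expressions -/

section pderiv

variable {E : Type*} [NormedAddCommGroup E] [NormedSpace ℝ E]

theorem continuous_update_line (x : Coord) (α : Fin 4) :
    Continuous fun s : ℝ => Function.update x α s :=
  continuous_const.update α continuous_id

/-- The coordinate line through `x` stays in `U` near `x`, so formulas known only on the region may
be differentiated. -/
theorem pderiv_congr_of_isOpen {U : Set Coord} (hU : IsOpen U) {F G : Coord → E}
    (h : ∀ y ∈ U, F y = G y) (hx : x ∈ U) (α : Fin 4) : pderiv α F x = pderiv α G x := by
  refine Filter.EventuallyEq.deriv_eq ?_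
  have hc : Filter.Tendsto (fun s : ℝ => Function.update x α s) (𝓝 (x α)) (𝓝 x) := by
    simpa using (continuous_update_line x α).tendsto (x α)
  filter_upwards [hc.eventually (hU.mem_nhds hx)] with s hs using h _ hs

end pderiv

theorem contDiffOn_kerrDelta {n : WithTop ℕ∞} (hm : ContDiffOn ℝ n m I) :
    ContDiffOn ℝ n (kerrDelta a m) I := by
  unfold kerrDelta
  fun_prop

theorem hasDerivAt_kerrDelta (hI : IsOpen I) (hm : ContDiffOn ℝ 2 m I) {r : ℝ} (hr : r ∈ I) :
    HasDerivAt (kerrDelta a m) (deriv (kerrDelta a m) r) r :=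
  (((contDiffOn_kerrDelta hm).differentiableOn (by norm_num)).differentiableAt
    (hI.mem_nhds hr)).hasDerivAt

theorem contDiffOn_deriv_kerrDelta (hI : IsOpen I) (hm : ContDiffOn ℝ 2 m I) :
    ContDiffOn ℝ 1 (deriv (kerrDelta a m)) I :=
  (contDiffOn_kerrDelta hm).deriv_of_isOpen hI (by norm_num)

theorem hasDerivAt_deriv_kerrDelta (hI : IsOpen I) (hm : ContDiffOn ℝ 2 m I) {r : ℝ}
    (hr : r ∈ I) :
    HasDerivAt (deriv (kerrDelta a m)) (deriv (deriv (kerrDelta a m)) r) r :=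
  (((contDiffOn_deriv_kerrDelta hI hm).differentiableOn one_ne_zero).differentiableAt
    (hI.mem_nhds hr)).hasDerivAt

/-- The generator `D₁` is where two derivatives of `m` are needed; the other generators involve at
most `Δ'`. -/
theorem hasDerivAt_eval_r (hI : IsOpen I) (hm : ContDiffOn ℝ 2 m I)
    (hx : x ∈ kerrRegion a m I) (e : KerrExpr) :
    HasDerivAt (fun s => e.eval (kerrEnv a m (Function.update x 1 s)))
      (e.evalDr (deriv (deriv (kerrDelta a m)) (x 1)) (kerrEnv a m x)) (x 1) := by
  have h2 : ∀ s : ℝ, Function.update x 1 s 2 = x 2 := fun s => by simp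
  have hS : ∀ s : ℝ, kerrSigma a (Function.update x 1 s) =
      s ^ 2 + a ^ 2 * Real.cos (x 2) ^ 2 := fun s => by simp [kerrSigma]
  induction e with
  | num n => exact hasDerivAt_const _ _
  | a => exact hasDerivAt_const _ _
  | r => simpa [KerrExpr.eval, KerrExpr.evalDr, kerrEnv] using hasDerivAt_id' (x 1)
  | s => simpa [KerrExpr.eval, KerrExpr.evalDr, kerrEnv] using hasDerivAt_const _ _
  | c => simpa [KerrExpr.eval, KerrExpr.evalDr, kerrEnv] using hasDerivAt_const _ _
  | D =>
    simpa [KerrExpr.eval, KerrExpr.evalDr, kerrEnv] using hasDerivAt_kerrDelta hI hm hx.1.1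
  | D₁ =>
    simpa [KerrExpr.eval, KerrExpr.evalDr, kerrEnv] using
      hasDerivAt_deriv_kerrDelta hI hm hx.1.1
  | iS =>
    simp only [KerrExpr.eval, KerrExpr.evalDr, kerrEnv, hS]
    refine ((((hasDerivAt_id' (x 1)).fun_pow 2).add_const
      (a ^ 2 * Real.cos (x 2) ^ 2)).fun_inv hx.2.2).congr_deriv ?_
    simp [kerrSigma, div_eq_mul_inv]
  | iD =>
    simp only [KerrExpr.eval, KerrExpr.evalDr, kerrEnv, Function.update_self]
    refine ((hasDerivAt_kerrDelta hI hm hx.1.1).fun_inv hx.1.2).congr_deriv ?_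
    simp [div_eq_mul_inv]
  | is => simpa [KerrExpr.eval, KerrExpr.evalDr, kerrEnv] using hasDerivAt_const _ _
  | add e f he hf => exact he.add hf
  | neg e he => exact he.neg
  | mul e f he hf => simpa [KerrExpr.eval, KerrExpr.evalDr] using he.fun_mul hf
  | pow e n he => simpa [KerrExpr.eval, KerrExpr.evalDr] using he.fun_pow n

theorem hasDerivAt_eval_θ (hx : x ∈ kerrRegion a m I) (e : KerrExpr) :
    HasDerivAt (fun s => e.eval (kerrEnv a m (Function.update x 2 s)))
      (e.evalDθ (kerrEnv a m x)) (x 2) := by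
  have hS : ∀ s : ℝ, kerrSigma a (Function.update x 2 s) =
      x 1 ^ 2 + a ^ 2 * Real.cos s ^ 2 := fun s => by simp [kerrSigma]
  have hs := Real.hasDerivAt_sin (x 2)
  have hc := Real.hasDerivAt_cos (x 2)
  induction e with
  | num n => exact hasDerivAt_const _ _
  | a => exact hasDerivAt_const _ _
  | r => simpa [KerrExpr.eval, KerrExpr.evalDθ, kerrEnv] using hasDerivAt_const _ _
  | s => simpa [KerrExpr.eval, KerrExpr.evalDθ, kerrEnv] using hs
  | c => simpa [KerrExpr.eval, KerrExpr.evalDθ, kerrEnv] using hc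
  | D => simpa [KerrExpr.eval, KerrExpr.evalDθ, kerrEnv] using hasDerivAt_const _ _
  | D₁ => simpa [KerrExpr.eval, KerrExpr.evalDθ, kerrEnv] using hasDerivAt_const _ _
  | iS =>
    simp only [KerrExpr.eval, KerrExpr.evalDθ, kerrEnv, hS]
    refine ((((hc.fun_pow 2).const_mul (a ^ 2)).const_add (x 1 ^ 2)).fun_inv
      hx.2.2).congr_deriv ?_
    simp only [kerrSigma, div_eq_mul_inv, ← inv_pow]
    ring
  | iD => simpa [KerrExpr.eval, KerrExpr.evalDθ, kerrEnv] using hasDerivAt_const _ _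
  | is =>
    simp only [KerrExpr.eval, KerrExpr.evalDθ, kerrEnv, Function.update_self]
    refine (hs.fun_inv (sin_pos_of_mem_kerrRegion hx).ne').congr_deriv ?_
    simp [div_eq_mul_inv]
  | add e f he hf => exact he.add hf
  | neg e he => exact he.neg
  | mul e f he hf => simpa [KerrExpr.eval, KerrExpr.evalDθ] using he.fun_mul hf
  | pow e n he => simpa [KerrExpr.eval, KerrExpr.evalDθ] using he.fun_pow n

theorem pderiv_eval (hI : IsOpen I) (hm : ContDiffOn ℝ 2 m I) (hx : x ∈ kerrRegion a m I)
    (α : Fin 4) (e : KerrExpr) :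
    pderiv α (fun y => e.eval (kerrEnv a m y)) x =
      e.evalPd (deriv (deriv (kerrDelta a m)) (x 1)) (kerrEnv a m x) α := by
  -- The coordinates `t` and `φ` are cyclic: no structure function depends on them.
  have hk : ∀ (β : Fin 4), β ≠ 1 → β ≠ 2 → ∀ s : ℝ,
      kerrEnv a m (Function.update x β s) = kerrEnv a m x := fun β h1 h2 s => by
    simp [kerrEnv, kerrSigma, h1.symm, h2.symm]
  fin_cases α
  · simp [pderiv, hk 0 (by decide) (by decide)]
  · exact (hasDerivAt_eval_r hI hm hx e).deriv
  · exact (hasDerivAt_eval_θ hx e).deriv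
  · simp [pderiv, hk 3 (by decide) (by decide)]

theorem pderiv_eq_evalPd (hI : IsOpen I) (hm : ContDiffOn ℝ 2 m I) {F : Coord → ℝ}
    {e : KerrExpr} (h : ∀ y ∈ kerrRegion a m I, F y = e.eval (kerrEnv a m y))
    (hx : x ∈ kerrRegion a m I) (α : Fin 4) :
    pderiv α F x = e.evalPd (deriv (deriv (kerrDelta a m)) (x 1)) (kerrEnv a m x) α := by
  rw [pderiv_congr_of_isOpen (isOpen_kerrRegion hI hm.continuousOn) h hx, pderiv_eval hI hm hx]

/-- The class is `C¹` because expressions may contain `Δ'`, which is only `C¹` when `m` is `C²`. -/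
theorem contDiffOn_eval (hI : IsOpen I) (hm : ContDiffOn ℝ 2 m I) (e : KerrExpr) :
    ContDiffOn ℝ 1 (fun y => e.eval (kerrEnv a m y)) (kerrRegion a m I) := by
  have hD : ContDiffOn ℝ 1 (fun y : Coord => kerrDelta a m (y 1)) (kerrRegion a m I) :=
    ((contDiffOn_kerrDelta hm).of_le (by norm_num)).comp (contDiff_apply ℝ ℝ 1).contDiffOn
      fun y hy => hy.1.1
  induction e with
  | num n => exact contDiffOn_const
  | a => exact contDiffOn_const
  | r => exact (contDiff_apply ℝ ℝ 1).contDiffOn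
  | s => exact (Real.contDiff_sin.comp (contDiff_apply ℝ ℝ 2)).contDiffOn
  | c => exact (Real.contDiff_cos.comp (contDiff_apply ℝ ℝ 2)).contDiffOn
  | D => exact hD
  | D₁ =>
    exact (contDiffOn_deriv_kerrDelta hI hm).comp (contDiff_apply ℝ ℝ 1).contDiffOn
      fun y hy => hy.1.1
  | iS =>
    refine ContDiffOn.inv (ContDiff.contDiffOn ?_) fun y hy => hy.2.2
    exact ((contDiff_apply ℝ ℝ 1).pow 2).add
      (contDiff_const.mul ((Real.contDiff_cos.comp (contDiff_apply ℝ ℝ 2)).pow 2))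
  | iD => exact hD.inv fun y hy => hy.1.2
  | is =>
    exact (Real.contDiff_sin.comp (contDiff_apply ℝ ℝ 2)).contDiffOn.inv
      fun y hy => (sin_pos_of_mem_kerrRegion hy).ne'
  | add e f he hf => exact he.add hf
  | neg e he => exact he.neg
  | mul e f he hf => exact he.mul hf
  | pow e n he => exact he.pow n

theorem contDiffOn_of_eq_eval (hI : IsOpen I) (hm : ContDiffOn ℝ 2 m I) {F : Coord → ℝ}
    {e : KerrExpr} (h : ∀ y ∈ kerrRegion a m I, F y = e.eval (kerrEnv a m y)) :
    ContDiffOn ℝ 1 F (kerrRegion a m I) :=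
  (contDiffOn_eval hI hm e).congr h

end

/-! ### Explicit metric, inverse metric and Christoffel symbols -/

namespace KerrExpr

/-- `Σ = r² + a² cos² θ`. -/
def sigma : KerrExpr := r ^ 2 + a ^ 2 * c ^ 2

/-- `r² + a²`. -/
def rho : KerrExpr := r ^ 2 + a ^ 2

/-- `2 r m(r) = r² + a² - Δ`. -/
def massTerm : KerrExpr := rho - D

/-- Half the `r`-derivative of `2 r m(r) / Σ`. -/
def potDeriv : KerrExpr := ((r - num (1 / 2) * D₁) * sigma - r * massTerm) * iS ^ 2

/-- The metric components. -/
def metric : Matrix (Fin 4) (Fin 4) KerrExpr :=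
  !![massTerm * iS - 1, 0, 0, -(a * s ^ 2 * massTerm * iS);
     0, sigma * iD, 0, 0;
     0, 0, sigma, 0;
     -(a * s ^ 2 * massTerm * iS), 0, 0, s ^ 2 * rho + a ^ 2 * s ^ 4 * massTerm * iS]

/-- The components of the inverse metric. -/
def inverseMetric : Matrix (Fin 4) (Fin 4) KerrExpr :=
  !![-(1 + rho * massTerm * iS * iD), 0, 0, -(a * massTerm * iS * iD);
     0, D * iS, 0, 0;
     0, 0, iS, 0;
     -(a * massTerm * iS * iD), 0, 0, iS * (is ^ 2 - a ^ 2 * iD)]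

/-- The Christoffel symbols. -/
def gamma : Fin 4 → Matrix (Fin 4) (Fin 4) KerrExpr :=
  let tr := -(rho * potDeriv * iD)
  let tθ := -(a ^ 2 * s * c * massTerm * iS ^ 2)
  let trφ := a * s ^ 2 * iD * (rho * potDeriv - r * massTerm * iS)
  let tθφ := a ^ 3 * s ^ 3 * c * massTerm * iS ^ 2
  let rtt := -(D * potDeriv * iS)
  let rtφ := a * s ^ 2 * D * potDeriv * iS
  let rrr := r * iS - num (1 / 2) * D₁ * iD
  let rrθ := -(a ^ 2 * s * c * iS)
  let rθθ := -(r * D * iS)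
  let rφφ := -(D * s ^ 2 * iS * (r + a ^ 2 * s ^ 2 * potDeriv))
  let θtt := -(a ^ 2 * s * c * massTerm * iS ^ 3)
  let θtφ := a * s * c * massTerm * rho * iS ^ 3
  let θrr := a ^ 2 * s * c * iS * iD
  let θrθ := r * iS
  let θφφ := -(s * c * iS ^ 3 *
    (rho * sigma ^ 2 + a ^ 2 * s ^ 2 * massTerm * (sigma + rho)))
  let φtr := -(a * potDeriv * iD)
  let φtθ := -(a * c * massTerm * iS ^ 2 * is)
  let φrφ := r * iS + a ^ 2 * s ^ 2 * iD * (potDeriv - r * iS)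
  let φθφ := c * is + a ^ 2 * s * c * massTerm * iS ^ 2
  ![!![0, tr, tθ, 0; tr, 0, 0, trφ; tθ, 0, 0, tθφ; 0, trφ, tθφ, 0],
    !![rtt, 0, 0, rtφ; 0, rrr, rrθ, 0; 0, rrθ, rθθ, 0; rtφ, 0, 0, rφφ],
    !![θtt, 0, 0, θtφ; 0, θrr, θrθ, 0; 0, θrθ, rrθ, 0; θtφ, 0, 0, θφφ],
    !![0, φtr, φtθ, 0; φtr, 0, 0, φrφ; φtθ, 0, 0, φθφ; 0, φrφ, φθφ, 0]]

end KerrExpr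

open KerrExpr

theorem metric_mul_inverseMetric {p : KerrEnv} (hp : p.Valid) (i j : Fin 4) :
    ∑ k, (metric i k).eval p * (inverseMetric k j).eval p = if i = j then 1 else 0 := by
  obtain ⟨a, r, s, c, D, D₁, iS, iD, is⟩ := p
  obtain ⟨hsc, hS, hD, hs, h1, h2, h3⟩ := hp
  simp only at hsc hS hD hs h1 h2 h3
  -- Read as a rewriting rule that eliminates even powers of `c`, the Pythagorean relation makes the
  -- remaining identities polynomial ones.
  have hc2 : c ^ 2 = 1 - s ^ 2 := by linear_combination hsc
  fin_cases i <;> fin_cases j <;>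
    simp [Fin.sum_univ_four, metric, inverseMetric, massTerm, rho, sigma, h1, h2, h3] <;>
    field_simp <;> simp only [hc2] <;> ring

set_option maxHeartbeats 4000000 in
theorem christoffel_eq_gamma_algebraic (D₂ : ℝ) {p : KerrEnv} (hp : p.Valid) (μ α β : Fin 4) :
    (1 / 2) * ∑ ν, (inverseMetric μ ν).eval p * ((metric ν β).evalPd D₂ p α +
      (metric ν α).evalPd D₂ p β - (metric α β).evalPd D₂ p ν) = (gamma μ α β).eval p := by
  obtain ⟨a, r, s, c, D, D₁, iS, iD, is⟩ := p
  obtain ⟨hsc, hS, hD, hs, h1, h2, h3⟩ := hp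
  simp only at hsc hS hD hs h1 h2 h3
  have hc2 : c ^ 2 = 1 - s ^ 2 := by linear_combination hsc
  -- `Σ` stays a single atom while denominators are cleared and is expanded only afterwards. The
  -- other component checks do the same.
  obtain ⟨S, hSc⟩ : ∃ S, S = r ^ 2 + a ^ 2 * c ^ 2 := ⟨_, rfl⟩
  rw [← hSc] at hS h1
  fin_cases μ <;> fin_cases α <;> fin_cases β <;>
    simp [Fin.sum_univ_four, metric, inverseMetric, gamma, massTerm, rho, sigma, potDeriv, h1, h2,
      h3] <;>
    field_simp <;> (try simp only [hSc, hc2]) <;> ring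

section

variable {a : ℝ} {m : ℝ → ℝ} {I : Set ℝ} {x : Coord}

theorem kerrMetric_eq (hx : x ∈ kerrRegion a m I) :
    kerrMetric a m x = metric.map (eval (kerrEnv a m x)) := by
  have hS : x 1 ^ 2 + a ^ 2 * Real.cos (x 2) ^ 2 ≠ 0 := hx.2.2
  have hD := hx.1.2
  have hc2 := Real.cos_sq' (x 2)
  ext i j
  fin_cases i <;> fin_cases j <;>
    simp [kerrMetric, metric, kerrEnv, massTerm, rho, sigma, kerrSigma] <;>
    field_simp <;> (try simp only [hc2]) <;> ring

theorem kerrMetric_apply (hx : x ∈ kerrRegion a m I) (i j : Fin 4) :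
    kerrMetric a m x i j = (metric i j).eval (kerrEnv a m x) := by
  rw [kerrMetric_eq hx, Matrix.map_apply]

theorem kerrMetric_mul_inverseMetric (hx : x ∈ kerrRegion a m I) :
    kerrMetric a m x * inverseMetric.map (eval (kerrEnv a m x)) = 1 := by
  ext i j
  rw [kerrMetric_eq hx, Matrix.mul_apply, Matrix.one_apply,
    ← metric_mul_inverseMetric (kerrEnv_valid hx) i j]
  rfl

theorem inv_kerrMetric_eq (hx : x ∈ kerrRegion a m I) :
    (kerrMetric a m x)⁻¹ = inverseMetric.map (eval (kerrEnv a m x)) :=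
  Matrix.inv_eq_right_inv (kerrMetric_mul_inverseMetric hx)

theorem isUnit_det_kerrMetric (hx : x ∈ kerrRegion a m I) : IsUnit (kerrMetric a m x).det :=
  Matrix.isUnit_det_of_right_inverse (kerrMetric_mul_inverseMetric hx)

theorem transpose_kerrMetric (x : Coord) : (kerrMetric a m x)ᵀ = kerrMetric a m x := by
  ext i j
  fin_cases i <;> fin_cases j <;> simp [kerrMetric, mul_comm]

theorem christoffel_kerrMetric (hI : IsOpen I) (hm : ContDiffOn ℝ 2 m I)
    (hx : x ∈ kerrRegion a m I) (μ α β : Fin 4) :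
    christoffel (kerrMetric a m) x μ α β = (gamma μ α β).eval (kerrEnv a m x) := by
  have hg : ∀ i j α, pderiv α (fun y => kerrMetric a m y i j) x = _ := fun i j =>
    pderiv_eq_evalPd hI hm (fun y hy => kerrMetric_apply hy i j) hx
  rw [← christoffel_eq_gamma_algebraic (deriv (deriv (kerrDelta a m)) (x 1)) (kerrEnv_valid hx)]
  simp only [christoffel, hg, inv_kerrMetric_eq hx, Matrix.map_apply]

theorem covDeriv_kerrMetric (hI : IsOpen I) (hm : ContDiffOn ℝ 2 m I) {T : Coord → Mat4}
    {F : Matrix (Fin 4) (Fin 4) KerrExpr}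
    (hT : ∀ y ∈ kerrRegion a m I, T y = F.map (eval (kerrEnv a m y)))
    (hx : x ∈ kerrRegion a m I) (α μ ν : Fin 4) :
    covDeriv (kerrMetric a m) T x α μ ν =
      (F μ ν).evalPd (deriv (deriv (kerrDelta a m)) (x 1)) (kerrEnv a m x) α
        - ∑ σ, ((gamma σ α μ).eval (kerrEnv a m x) * (F σ ν).eval (kerrEnv a m x)
          + (gamma σ α ν).eval (kerrEnv a m x) * (F μ σ).eval (kerrEnv a m x)) := by
  have h : ∀ y ∈ kerrRegion a m I, T y μ ν = (F μ ν).eval (kerrEnv a m y) := fun y hy => by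
    rw [hT y hy, Matrix.map_apply]
  simp only [covDeriv, pderiv_eq_evalPd hI hm h hx, christoffel_kerrMetric hI hm hx, hT x hx,
    Matrix.map_apply]

theorem ricci_kerrMetric (hI : IsOpen I) (hm : ContDiffOn ℝ 2 m I)
    (hx : x ∈ kerrRegion a m I) (μ ν : Fin 4) :
    ricci (kerrMetric a m) x μ ν =
      ∑ σ, ((gamma σ μ ν).evalPd (deriv (deriv (kerrDelta a m)) (x 1)) (kerrEnv a m x) σ
        - (gamma σ μ σ).evalPd (deriv (deriv (kerrDelta a m)) (x 1)) (kerrEnv a m x) ν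
        + ∑ τ, ((gamma σ τ σ).eval (kerrEnv a m x) * (gamma τ μ ν).eval (kerrEnv a m x)
          - (gamma σ τ ν).eval (kerrEnv a m x) * (gamma τ μ σ).eval (kerrEnv a m x))) := by
  have h : ∀ μ ν β α, pderiv α (fun y => christoffel (kerrMetric a m) y μ ν β) x = _ :=
    fun μ ν β => pderiv_eq_evalPd hI hm
      (fun y hy => christoffel_kerrMetric hI hm hy μ ν β) hx
  simp only [ricci, riemann, h, christoffel_kerrMetric hI hm hx, Matrix.of_apply]

theorem Matrix.det_stationary_axisymmetric {R : Type*} [CommRing R] (A B C E F : R) :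
    Matrix.det !![A, 0, 0, B; 0, C, 0, 0; 0, 0, E, 0; B, 0, 0, F] =
      C * E * (A * F - B ^ 2) := by
  simp [Matrix.det_succ_row_zero, Fin.sum_univ_succ, Fin.succAbove]
  ring

/-- The `(t, φ)` block has determinant `-Δ sin²θ` and `g_rr g_θθ = Σ²/Δ`, so `Δ` cancels. The
signature is thus Lorentzian for either sign of `Δ`. -/
theorem det_kerrMetric (hx : x ∈ kerrRegion a m I) :
    (kerrMetric a m x).det = -(kerrSigma a x * Real.sin (x 2)) ^ 2 := by
  have hS : x 1 ^ 2 + a ^ 2 * Real.cos (x 2) ^ 2 ≠ 0 := hx.2.2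
  have hD := hx.1.2
  have hc2 := Real.cos_sq' (x 2)
  rw [kerrMetric_eq hx]
  have := Matrix.det_stationary_axisymmetric ((metric 0 0).eval (kerrEnv a m x))
    ((metric 0 3).eval (kerrEnv a m x)) ((metric 1 1).eval (kerrEnv a m x))
    ((metric 2 2).eval (kerrEnv a m x)) ((metric 3 3).eval (kerrEnv a m x))
  convert this using 1
  · congr 1
    ext i j
    fin_cases i <;> fin_cases j <;> simp [metric]
  · simp [metric, kerrEnv, massTerm, rho, sigma, kerrSigma]
    field_simp
    simp only [hc2]
    ring

end

/-! ### Covariant derivatives of the Killing tensors, the two-forms and the Killing vectors -/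

namespace KerrExpr

/-- The part `-(Δ/Σ)(dt - a sin²θ dφ)² + (Σ/Δ) dr²` of the metric. -/
def radialForm : Matrix (Fin 4) (Fin 4) KerrExpr :=
  !![-(D * iS), 0, 0, a * s ^ 2 * D * iS;
     0, sigma * iD, 0, 0;
     0, 0, 0, 0;
     a * s ^ 2 * D * iS, 0, 0, -(a ^ 2 * s ^ 4 * D * iS)]

/-- The covariant components of the Killing tensor. -/
def killing : Matrix (Fin 4) (Fin 4) KerrExpr :=
  Matrix.of fun i j => sigma * radialForm i j - r ^ 2 * metric i j

/-- The covariant components of the Papadopoulos–Kokkotas tensor. -/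
def killingPK : Matrix (Fin 4) (Fin 4) KerrExpr :=
  Matrix.of fun i j => -killing i j - (a ^ 2 * (metric 0 i * metric 0 j)
    + a * (metric 0 i * metric 3 j + metric 3 i * metric 0 j))

/-- The components of the Killing–Yano two-form. -/
def yano : Matrix (Fin 4) (Fin 4) KerrExpr :=
  !![0, a * c, -(a * r * s), 0;
     -(a * c), 0, 0, a ^ 2 * c * s ^ 2;
     a * r * s, 0, 0, -(r * s * rho);
     0, -(a ^ 2 * c * s ^ 2), r * s * rho, 0]

/-- The components of the principal tensor. -/
def principal : Matrix (Fin 4) (Fin 4) KerrExpr :=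
  !![0, -r, -(a ^ 2 * c * s), 0;
     r, 0, 0, -(a * r * s ^ 2);
     a ^ 2 * c * s, 0, 0, -(a * c * s * rho);
     0, a * r * s ^ 2, a * c * s * rho, 0]

/-- The Levi-Civita symbol of `(r, θ, φ)`. -/
def spatialLeviCivita : Fin 4 → Mat4 :=
  ![0, !![0, 0, 0, 0; 0, 0, 0, 0; 0, 0, 0, 1; 0, 0, -1, 0],
    !![0, 0, 0, 0; 0, 0, 0, -1; 0, 0, 0, 0; 0, 1, 0, 0],
    !![0, 0, 0, 0; 0, 0, 1, 0; 0, -1, 0, 0; 0, 0, 0, 0]]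

/-- The value of the covariant derivative `∇_α F_{μν}`. -/
def evalCov (D₂ : ℝ) (p : KerrEnv) (F : Matrix (Fin 4) (Fin 4) KerrExpr) (α μ ν : Fin 4) : ℝ :=
  (F μ ν).evalPd D₂ p α
    - ∑ σ, ((gamma σ α μ).eval p * (F σ ν).eval p + (gamma σ α ν).eval p * (F μ σ).eval p)

/-- The value of the covariant derivative `∇_α u_μ`. -/
def evalCov₁ (D₂ : ℝ) (p : KerrEnv) (u : Fin 4 → KerrExpr) (α μ : Fin 4) : ℝ :=
  (u μ).evalPd D₂ p α - ∑ σ, (gamma σ α μ).eval p * (u σ).eval p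

theorem evalPd_mul (D₂ : ℝ) (p : KerrEnv) (α : Fin 4) (e f : KerrExpr) :
    (e * f).evalPd D₂ p α = e.evalPd D₂ p α * f.eval p + e.eval p * f.evalPd D₂ p α := by
  fin_cases α <;> simp

/-- Leibniz rule for `u ⊗ v`, used for products of Killing covectors. -/
theorem evalCov_mul (D₂ : ℝ) (p : KerrEnv) (u v : Fin 4 → KerrExpr) (α μ ν : Fin 4) :
    evalCov D₂ p (Matrix.of fun i j => u i * v j) α μ ν =
      evalCov₁ D₂ p u α μ * (v ν).eval p + (u μ).eval p * evalCov₁ D₂ p v α ν := by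
  simp only [evalCov, evalCov₁, evalPd_mul, Matrix.of_apply, eval_mul, Fin.sum_univ_four]
  ring

theorem evalCov_antisymm {D₂ : ℝ} {p : KerrEnv} {F : Matrix (Fin 4) (Fin 4) KerrExpr}
    (h : ∀ i j, (F i j).eval p = -(F j i).eval p)
    (h' : ∀ i j α, (F i j).evalPd D₂ p α = -(F j i).evalPd D₂ p α) (α μ ν : Fin 4) :
    evalCov D₂ p F α μ ν = -evalCov D₂ p F α ν μ := by
  simp only [evalCov, h' μ ν, h μ, h _ ν, Fin.sum_univ_four]
  ring

theorem evalCov_yano_antisymm (D₂ : ℝ) (p : KerrEnv) (α μ ν : Fin 4) :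
    evalCov D₂ p yano α μ ν = -evalCov D₂ p yano α ν μ := by
  refine evalCov_antisymm (fun i j => ?_) (fun i j α => ?_) α μ ν
  · fin_cases i <;> fin_cases j <;> simp [yano]
  · fin_cases α <;> fin_cases i <;> fin_cases j <;> simp [yano]

theorem evalCov_principal_antisymm (D₂ : ℝ) (p : KerrEnv) (α μ ν : Fin 4) :
    evalCov D₂ p principal α μ ν = -evalCov D₂ p principal α ν μ := by
  refine evalCov_antisymm (fun i j => ?_) (fun i j α => ?_) α μ ν
  · fin_cases i <;> fin_cases j <;> simp [principal]
  · fin_cases α <;> fin_cases i <;> fin_cases j <;> simp [principal]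

end KerrExpr

theorem spatialLeviCivita_antisymm (α μ ν : Fin 4) :
    spatialLeviCivita α μ ν = -spatialLeviCivita α ν μ := by
  fin_cases α <;> fin_cases μ <;> fin_cases ν <;> simp [spatialLeviCivita]

set_option maxHeartbeats 4000000 in
-- Since `√-g = Σ sin θ`, the right side is minus the volume form contracted with `∂_t`.
-- Antisymmetry of `f` leaves only `μ < ν` to compute.
theorem evalCov_yano_of_lt (D₂ : ℝ) {p : KerrEnv} (hp : p.Valid) (α : Fin 4) {μ ν : Fin 4}
    (h : μ < ν) :
    evalCov D₂ p yano α μ ν =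
      -((p.r ^ 2 + p.a ^ 2 * p.c ^ 2) * p.s) * spatialLeviCivita α μ ν := by
  obtain ⟨a, r, s, c, D, D₁, iS, iD, is⟩ := p
  obtain ⟨hsc, hS, hD, hs, h1, h2, h3⟩ := hp
  simp only at hsc hS hD hs h1 h2 h3
  have hc2 : c ^ 2 = 1 - s ^ 2 := by linear_combination hsc
  obtain ⟨S, hSc⟩ : ∃ S, S = r ^ 2 + a ^ 2 * c ^ 2 := ⟨_, rfl⟩
  rw [← hSc] at hS h1
  fin_cases α <;> fin_cases μ <;> fin_cases ν <;>
    first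
    | exact absurd h (by decide)
    | (simp [evalCov, Fin.sum_univ_four, yano, gamma, massTerm, rho, sigma, potDeriv, h1, h2, h3,
        spatialLeviCivita] <;>
      field_simp <;> (try simp only [hSc, hc2]) <;> ring)

theorem evalCov_yano (D₂ : ℝ) {p : KerrEnv} (hp : p.Valid) (α μ ν : Fin 4) :
    evalCov D₂ p yano α μ ν =
      -((p.r ^ 2 + p.a ^ 2 * p.c ^ 2) * p.s) * spatialLeviCivita α μ ν := by
  rcases lt_trichotomy μ ν with h | rfl | h
  · exact evalCov_yano_of_lt D₂ hp α h
  · rw [self_eq_neg.1 (evalCov_yano_antisymm D₂ p α μ μ),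
      self_eq_neg.1 (spatialLeviCivita_antisymm α μ μ), mul_zero]
  · rw [evalCov_yano_antisymm, evalCov_yano_of_lt D₂ hp α h, spatialLeviCivita_antisymm, mul_neg,
      neg_neg]

set_option maxHeartbeats 4000000 in
-- Row `0` of the metric is `∂_t` lowered. The right side already has the closed conformal
-- Killing–Yano shape, with this covector in place of a divergence.
theorem evalCov_principal_of_lt (D₂ : ℝ) {p : KerrEnv} (hp : p.Valid) (μ : Fin 4) {ν α : Fin 4}
    (h : ν < α) :
    evalCov D₂ p principal μ ν α =
      (metric μ α).eval p * (metric 0 ν).eval p - (metric μ ν).eval p * (metric 0 α).eval p := by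
  obtain ⟨a, r, s, c, D, D₁, iS, iD, is⟩ := p
  obtain ⟨hsc, hS, hD, hs, h1, h2, h3⟩ := hp
  simp only at hsc hS hD hs h1 h2 h3
  have hc2 : c ^ 2 = 1 - s ^ 2 := by linear_combination hsc
  obtain ⟨S, hSc⟩ : ∃ S, S = r ^ 2 + a ^ 2 * c ^ 2 := ⟨_, rfl⟩
  rw [← hSc] at hS h1
  fin_cases α <;> fin_cases μ <;> fin_cases ν <;>
    first
    | exact absurd h (by decide)
    | (simp [evalCov, Fin.sum_univ_four, principal, metric, gamma, massTerm, rho, sigma, potDeriv,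
        h1, h2, h3] <;>
      field_simp <;> (try simp only [hSc, hc2]) <;> ring)

theorem evalCov_principal (D₂ : ℝ) {p : KerrEnv} (hp : p.Valid) (μ ν α : Fin 4) :
    evalCov D₂ p principal μ ν α =
      (metric μ α).eval p * (metric 0 ν).eval p - (metric μ ν).eval p * (metric 0 α).eval p := by
  rcases lt_trichotomy ν α with h | rfl | h
  · exact evalCov_principal_of_lt D₂ hp μ h
  · rw [self_eq_neg.1 (evalCov_principal_antisymm D₂ p μ ν ν), sub_self]
  · rw [evalCov_principal_antisymm, evalCov_principal_of_lt D₂ hp μ h, neg_sub]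

set_option maxHeartbeats 4000000 in
theorem evalCov_killing_of_le (D₂ : ℝ) {p : KerrEnv} (hp : p.Valid) {μ ν α : Fin 4}
    (h : μ ≤ ν ∧ ν ≤ α) :
    evalCov D₂ p killing α μ ν + evalCov D₂ p killing μ ν α + evalCov D₂ p killing ν α μ = 0 := by
  obtain ⟨a, r, s, c, D, D₁, iS, iD, is⟩ := p
  obtain ⟨hsc, hS, hD, hs, h1, h2, h3⟩ := hp
  simp only at hsc hS hD hs h1 h2 h3
  have hc2 : c ^ 2 = 1 - s ^ 2 := by linear_combination hsc
  obtain ⟨S, hSc⟩ : ∃ S, S = r ^ 2 + a ^ 2 * c ^ 2 := ⟨_, rfl⟩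
  rw [← hSc] at hS h1
  fin_cases α <;> fin_cases μ <;> fin_cases ν <;> first
    | exact absurd h (by decide)
    | (simp [evalCov, Fin.sum_univ_four, killing, radialForm, metric, gamma, massTerm, rho, sigma,
        potDeriv, h1, h2, h3] <;>
      field_simp <;> (try simp only [hSc, hc2]) <;> ring)

theorem evalCov_killing_comm (D₂ : ℝ) (p : KerrEnv) (α μ ν : Fin 4) :
    evalCov D₂ p killing α μ ν = evalCov D₂ p killing α ν μ := by
  have h : ∀ i j, killing i j = killing j i := fun i j => by
    fin_cases i <;> fin_cases j <;> rfl
  simp only [evalCov, h μ, h _ ν]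
  congr 1
  exact Finset.sum_congr rfl fun σ _ => add_comm _ _

theorem evalCov_killing (D₂ : ℝ) {p : KerrEnv} (hp : p.Valid) (μ ν α : Fin 4) :
    evalCov D₂ p killing α μ ν + evalCov D₂ p killing μ ν α + evalCov D₂ p killing ν α μ = 0 := by
  have h1 := evalCov_killing_comm D₂ p α μ ν
  have h2 := evalCov_killing_comm D₂ p μ ν α
  have h3 := evalCov_killing_comm D₂ p ν α μ
  -- As `K` is symmetric, the cyclic sum is invariant under all permutations of the indices, so
  -- sorted triples suffice. Two of the eight cases are cyclic chains, in which the indices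
  -- coincide.
  rcases le_total μ ν with h | h <;> rcases le_total ν α with h' | h' <;>
    rcases le_total μ α with h'' | h''
  · linarith [evalCov_killing_of_le D₂ hp ⟨h, h'⟩]
  · linarith [evalCov_killing_of_le D₂ hp ⟨h, h'⟩]
  · linarith [evalCov_killing_of_le D₂ hp ⟨h'', h'⟩]
  · linarith [evalCov_killing_of_le D₂ hp ⟨h'', h⟩]
  · linarith [evalCov_killing_of_le D₂ hp ⟨h, h''⟩]
  · linarith [evalCov_killing_of_le D₂ hp ⟨h', h''⟩]
  · linarith [evalCov_killing_of_le D₂ hp ⟨h', h⟩]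
  · linarith [evalCov_killing_of_le D₂ hp ⟨h', h⟩]

/-- Rows `0` and `3` of the metric are `∂_t` and `∂_φ` lowered, so this is Killing's equation for
both. -/
theorem evalCov₁_metric_antisymm (D₂ : ℝ) {p : KerrEnv} (hp : p.Valid) {k : Fin 4}
    (hk : k = 0 ∨ k = 3) (μ ν : Fin 4) :
    evalCov₁ D₂ p (metric k) μ ν + evalCov₁ D₂ p (metric k) ν μ = 0 := by
  obtain ⟨a, r, s, c, D, D₁, iS, iD, is⟩ := p
  obtain ⟨hsc, hS, hD, hs, h1, h2, h3⟩ := hp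
  simp only at hsc hS hD hs h1 h2 h3
  have hc2 : c ^ 2 = 1 - s ^ 2 := by linear_combination hsc
  obtain ⟨S, hSc⟩ : ∃ S, S = r ^ 2 + a ^ 2 * c ^ 2 := ⟨_, rfl⟩
  rw [← hSc] at hS h1
  rcases hk with rfl | rfl <;> fin_cases μ <;> fin_cases ν <;>
    simp [evalCov₁, Fin.sum_univ_four, metric, gamma, massTerm, rho, sigma, potDeriv,
      h1, h2, h3] <;>
    field_simp <;> (try simp only [hSc, hc2]) <;> ring

theorem evalCov_killingPK (D₂ : ℝ) {p : KerrEnv} (hp : p.Valid) (μ ν α : Fin 4) :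
    evalCov D₂ p killingPK α μ ν + evalCov D₂ p killingPK μ ν α
      + evalCov D₂ p killingPK ν α μ = 0 := by
  have h : ∀ α μ ν, evalCov D₂ p killingPK α μ ν = -evalCov D₂ p killing α μ ν
      - (p.a ^ 2 * evalCov D₂ p (Matrix.of fun i j => metric 0 i * metric 0 j) α μ ν
        + p.a * (evalCov D₂ p (Matrix.of fun i j => metric 0 i * metric 3 j) α μ ν
          + evalCov D₂ p (Matrix.of fun i j => metric 3 i * metric 0 j) α μ ν)) := by
    intro α μ ν
    -- The identity is linear in `K`, whose entries can stay opaque.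
    generalize hK : killing = K
    fin_cases α <;> simp [evalCov, killingPK, Fin.sum_univ_four, hK] <;> ring
  have h0 := evalCov₁_metric_antisymm D₂ hp (Or.inl rfl : (0 : Fin 4) = 0 ∨ _)
  have h3 := evalCov₁_metric_antisymm D₂ hp (Or.inr rfl : (3 : Fin 4) = 0 ∨ _)
  simp only [h, evalCov_mul]
  -- In the cyclic sum of the Leibniz terms, each instance of Killing's equation on two indices is
  -- multiplied by covectors carrying the third.
  linear_combination -evalCov_killing D₂ hp μ ν α
    - (p.a ^ 2 * (metric 0 ν).eval p + p.a * (metric 3 ν).eval p) * h0 α μ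
    - (p.a ^ 2 * (metric 0 α).eval p + p.a * (metric 3 α).eval p) * h0 μ ν
    - (p.a ^ 2 * (metric 0 μ).eval p + p.a * (metric 3 μ).eval p) * h0 ν α
    - p.a * (metric 0 ν).eval p * h3 α μ - p.a * (metric 0 α).eval p * h3 μ ν
    - p.a * (metric 0 μ).eval p * h3 ν α

/-! ## Determinants and the Levi-Civita symbol -/

theorem Matrix.det_fin_four_antisymm {R : Type*} [CommRing R] (A B C D E F : R) :
    Matrix.det !![0, A, B, C; -A, 0, D, E; -B, -D, 0, F; -C, -E, -F, 0] =
      (A * F - B * E + C * D) ^ 2 := by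
  simp [Matrix.det_succ_row_zero, Fin.sum_univ_succ, Fin.succAbove]
  ring

/-- With the indices as a function `v`, a repeated index is a repeated row of the determinant and a
transposition is a row swap. -/
theorem leviCivita_apply (v : Fin 4 → Fin 4) : leviCivita (v 0) (v 1) (v 2) (v 3) =
    Matrix.det (Matrix.of fun i j : Fin 4 => if v i = j then (1 : ℝ) else 0) := by
  have hv : ![v 0, v 1, v 2, v 3] = v := by
    ext k
    fin_cases k <;> rfl
  rw [leviCivita, hv]

theorem leviCivita_eq_zero_of_eq {v : Fin 4 → Fin 4} {i j : Fin 4} (hij : i ≠ j)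
    (h : v i = v j) : leviCivita (v 0) (v 1) (v 2) (v 3) = 0 := by
  rw [leviCivita_apply]
  exact Matrix.det_zero_of_row_eq hij (by ext k; simp [h])

theorem leviCivita_comp_swap (v : Fin 4 → Fin 4) {i j : Fin 4} (hij : i ≠ j) :
    leviCivita (v (Equiv.swap i j 0)) (v (Equiv.swap i j 1)) (v (Equiv.swap i j 2))
      (v (Equiv.swap i j 3)) = -leviCivita (v 0) (v 1) (v 2) (v 3) := by
  have h := Matrix.det_permute (Equiv.swap i j)
    (Matrix.of fun k l : Fin 4 => if v k = l then (1 : ℝ) else 0)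
  rw [Equiv.Perm.sign_swap hij] at h
  rw [leviCivita_apply v, leviCivita_apply fun k => v (Equiv.swap i j k)]
  refine h.trans ?_
  simp

theorem leviCivita_swap₀₁ (i j k l : Fin 4) : leviCivita i j k l = -leviCivita j i k l :=
  leviCivita_comp_swap ![j, i, k, l] (i := 0) (j := 1) (by decide)

theorem leviCivita_swap₂₃ (i j k l : Fin 4) : leviCivita i j k l = -leviCivita i j l k :=
  leviCivita_comp_swap ![i, j, l, k] (i := 2) (j := 3) (by decide)

theorem leviCivita_self₀₁ (i j k : Fin 4) : leviCivita i i j k = 0 :=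
  leviCivita_eq_zero_of_eq (v := ![i, i, j, k]) (i := 0) (j := 1) (by decide) rfl

theorem leviCivita_self₀₂ (i j k : Fin 4) : leviCivita i j i k = 0 :=
  leviCivita_eq_zero_of_eq (v := ![i, j, i, k]) (i := 0) (j := 2) (by decide) rfl

theorem leviCivita_self₀₃ (i j k : Fin 4) : leviCivita i j k i = 0 :=
  leviCivita_eq_zero_of_eq (v := ![i, j, k, i]) (i := 0) (j := 3) (by decide) rfl

theorem leviCivita_self₁₂ (i j k : Fin 4) : leviCivita i j j k = 0 :=
  leviCivita_eq_zero_of_eq (v := ![i, j, j, k]) (i := 1) (j := 2) (by decide) rfl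

theorem leviCivita_self₁₃ (i j k : Fin 4) : leviCivita i j k j = 0 :=
  leviCivita_eq_zero_of_eq (v := ![i, j, k, j]) (i := 1) (j := 3) (by decide) rfl

theorem leviCivita_self₂₃ (i j k : Fin 4) : leviCivita i j k k = 0 :=
  leviCivita_eq_zero_of_eq (v := ![i, j, k, k]) (i := 2) (j := 3) (by decide) rfl

theorem leviCivita_contract (F : Mat4) :
    (Matrix.of fun μ ν => ∑ α, ∑ β, leviCivita μ ν α β * F α β) =
      !![0, F 2 3 - F 3 2, F 3 1 - F 1 3, F 1 2 - F 2 1;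
         F 3 2 - F 2 3, 0, F 0 3 - F 3 0, F 2 0 - F 0 2;
         F 1 3 - F 3 1, F 3 0 - F 0 3, 0, F 0 1 - F 1 0;
         F 2 1 - F 1 2, F 0 2 - F 2 0, F 1 0 - F 0 1, 0] := by
  -- One value for each splitting of the four indices into two increasing pairs; swaps within the
  -- pairs give all the others.
  have h₁ : leviCivita 0 1 2 3 = 1 := by
    simp [leviCivita, Matrix.det_succ_row_zero, Fin.sum_univ_succ, Fin.succAbove]
  have h₂ : leviCivita 0 2 1 3 = -1 := by
    simp [leviCivita, Matrix.det_succ_row_zero, Fin.sum_univ_succ, Fin.succAbove]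
  have h₃ : leviCivita 0 3 1 2 = 1 := by
    simp [leviCivita, Matrix.det_succ_row_zero, Fin.sum_univ_succ, Fin.succAbove]
  have h₄ : leviCivita 1 2 0 3 = 1 := by
    simp [leviCivita, Matrix.det_succ_row_zero, Fin.sum_univ_succ, Fin.succAbove]
  have h₅ : leviCivita 1 3 0 2 = -1 := by
    simp [leviCivita, Matrix.det_succ_row_zero, Fin.sum_univ_succ, Fin.succAbove]
  have h₆ : leviCivita 2 3 0 1 = 1 := by
    simp [leviCivita, Matrix.det_succ_row_zero, Fin.sum_univ_succ, Fin.succAbove]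
  ext μ ν
  fin_cases μ <;> fin_cases ν <;>
    simp [Fin.sum_univ_four, leviCivita_self₀₁, leviCivita_self₀₂, leviCivita_self₀₃,
      leviCivita_self₁₂, leviCivita_self₁₃, leviCivita_self₂₃, leviCivita_swap₀₁ 1 0,
      leviCivita_swap₀₁ 2 0, leviCivita_swap₀₁ 3 0, leviCivita_swap₀₁ 2 1,
      leviCivita_swap₀₁ 3 1, leviCivita_swap₀₁ 3 2, leviCivita_swap₂₃ _ _ 1 0,
      leviCivita_swap₂₃ _ _ 2 0, leviCivita_swap₂₃ _ _ 3 0, leviCivita_swap₂₃ _ _ 2 1,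
      leviCivita_swap₂₃ _ _ 3 1, leviCivita_swap₂₃ _ _ 3 2, h₁, h₂, h₃, h₄, h₅, h₆] <;>
    ring

/-! ## Algebra of the explicit components -/

namespace KerrExpr

/-- The contravariant components of the Killing tensor. -/
def killingUp : Matrix (Fin 4) (Fin 4) KerrExpr :=
  !![-(a ^ 2 * c ^ 2 * iS * iD * rho ^ 2) - r ^ 2 * iS * a ^ 2 * s ^ 2, 0, 0,
       -(a ^ 2 * c ^ 2 * iS * iD * rho * a) - r ^ 2 * iS * a;
     0, a ^ 2 * c ^ 2 * D * iS, 0, 0;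
     0, 0, -(r ^ 2 * iS), 0;
     -(a ^ 2 * c ^ 2 * iS * iD * rho * a) - r ^ 2 * iS * a, 0, 0,
       -(a ^ 2 * c ^ 2 * iS * iD * a ^ 2) - r ^ 2 * iS * is ^ 2]

/-- The contravariant components of the Killing–Yano two-form. -/
def yanoUp : Matrix (Fin 4) (Fin 4) KerrExpr :=
  !![0, -(a * c * rho * iS), a * r * s * iS, 0;
     a * c * rho * iS, 0, 0, a ^ 2 * c * iS;
     -(a * r * s * iS), 0, 0, -(r * iS * is);
     0, -(a ^ 2 * c * iS), r * iS * is, 0]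

end KerrExpr

set_option maxHeartbeats 1000000 in
theorem metric_mul_killingUp_mul_metric {p : KerrEnv} (hp : p.Valid) :
    metric.map (eval p) * killingUp.map (eval p) * metric.map (eval p) =
      killing.map (eval p) := by
  obtain ⟨a, r, s, c, D, D₁, iS, iD, is⟩ := p
  obtain ⟨hsc, hS, hD, hs, h1, h2, h3⟩ := hp
  simp only at hsc hS hD hs h1 h2 h3
  have hc2 : c ^ 2 = 1 - s ^ 2 := by linear_combination hsc
  obtain ⟨S, hSc⟩ : ∃ S, S = r ^ 2 + a ^ 2 * c ^ 2 := ⟨_, rfl⟩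
  rw [← hSc] at hS h1
  ext i j
  fin_cases i <;> fin_cases j <;>
    simp [Matrix.mul_apply, Fin.sum_univ_four, killingUp, killing, radialForm, metric, massTerm,
      rho, sigma, h1, h2, h3, -mul_eq_mul_left_iff, -mul_eq_mul_right_iff] <;>
    field_simp <;> (try simp only [hSc, hc2]) <;> ring

theorem yano_mul_inverseMetric_mul_yano {p : KerrEnv} (hp : p.Valid) :
    yano.map (eval p) * inverseMetric.map (eval p) * yano.map (eval p) =
      killing.map (eval p) := by
  obtain ⟨a, r, s, c, D, D₁, iS, iD, is⟩ := p
  obtain ⟨hsc, hS, hD, hs, h1, h2, h3⟩ := hp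
  simp only at hsc hS hD hs h1 h2 h3
  have hc2 : c ^ 2 = 1 - s ^ 2 := by linear_combination hsc
  obtain ⟨S, hSc⟩ : ∃ S, S = r ^ 2 + a ^ 2 * c ^ 2 := ⟨_, rfl⟩
  rw [← hSc] at hS h1
  ext i j
  fin_cases i <;> fin_cases j <;>
    simp [Matrix.mul_apply, Fin.sum_univ_four, yano, inverseMetric, killing, radialForm, metric,
      massTerm, rho, sigma, h1, h2, h3, -mul_eq_mul_left_iff, -mul_eq_mul_right_iff] <;>
    field_simp <;> (try simp only [hSc, hc2]) <;> ring

theorem inverseMetric_mul_yano_mul_inverseMetric {p : KerrEnv} (hp : p.Valid) :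
    inverseMetric.map (eval p) * yano.map (eval p) * inverseMetric.map (eval p) =
      yanoUp.map (eval p) := by
  obtain ⟨a, r, s, c, D, D₁, iS, iD, is⟩ := p
  obtain ⟨hsc, hS, hD, hs, h1, h2, h3⟩ := hp
  simp only at hsc hS hD hs h1 h2 h3
  have hc2 : c ^ 2 = 1 - s ^ 2 := by linear_combination hsc
  obtain ⟨S, hSc⟩ : ∃ S, S = r ^ 2 + a ^ 2 * c ^ 2 := ⟨_, rfl⟩
  rw [← hSc] at hS h1
  ext i j
  fin_cases i <;> fin_cases j <;>
    simp [Matrix.mul_apply, Fin.sum_univ_four, yano, yanoUp, inverseMetric,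
      massTerm, rho, h1, h2, h3, -mul_eq_mul_left_iff, -mul_eq_mul_right_iff] <;>
    field_simp <;> (try simp only [hSc, hc2]) <;> ring

/-- The eigenvalue of the Ricci tensor on the plane of `∂_θ` and `a sin²θ ∂_t + ∂_φ`. -/
def ricciAngular (p : KerrEnv) : ℝ :=
  (p.r * (2 * p.r - p.D₁) - (p.r ^ 2 + p.a ^ 2 - p.D)) * p.iS ^ 2

/-- The eigenvalue of the Ricci tensor on the plane of `∂_r` and `(r² + a²) ∂_t + a ∂_φ`. -/
def ricciRadial (D₂ : ℝ) (p : KerrEnv) : ℝ := (2 - D₂) / 2 * p.iS - ricciAngular p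

set_option maxHeartbeats 4000000 in
-- The Ricci tensor has two eigenvalues, each on a plane, and these are the eigenplanes of `K`.
-- `Δ''` enters only through `ricciRadial`.
theorem ricci_algebraic (D₂ : ℝ) {p : KerrEnv} (hp : p.Valid) (μ ν : Fin 4) :
    ∑ σ, ((gamma σ μ ν).evalPd D₂ p σ - (gamma σ μ σ).evalPd D₂ p ν
        + ∑ τ, ((gamma σ τ σ).eval p * (gamma τ μ ν).eval p
          - (gamma σ τ ν).eval p * (gamma τ μ σ).eval p)) =
      ricciAngular p * (metric μ ν).eval p
        + (ricciRadial D₂ p - ricciAngular p) * (radialForm μ ν).eval p := by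
  obtain ⟨a, r, s, c, D, D₁, iS, iD, is⟩ := p
  obtain ⟨hsc, hS, hD, hs, h1, h2, h3⟩ := hp
  simp only at hsc hS hD hs h1 h2 h3
  have hc2 : c ^ 2 = 1 - s ^ 2 := by linear_combination hsc
  obtain ⟨S, hSc⟩ : ∃ S, S = r ^ 2 + a ^ 2 * c ^ 2 := ⟨_, rfl⟩
  rw [← hSc] at hS h1
  fin_cases μ <;> fin_cases ν <;>
    simp [Fin.sum_univ_four, metric, radialForm, ricciRadial, ricciAngular, gamma, massTerm, rho,
      sigma, potDeriv, h1, h2, h3] <;>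
    field_simp <;> (try simp only [hSc, hc2]) <;> ring

variable {a : ℝ} {m : ℝ → ℝ} {I : Set ℝ} {x : Coord}

/-! ## The natural tetrad -/

/-- The co-tetrad without its normalisation factors. -/
def unnormalizedCotetrad (a : ℝ) (x : Coord) : Mat4 :=
  !![-1, 0, 0, a * Real.sin (x 2) ^ 2;
     0, 1, 0, 0;
     0, 0, 1, 0;
     -a, 0, 0, x 1 ^ 2 + a ^ 2]

/-- The normalisation factors of the co-tetrad. -/
def cotetradScale (a : ℝ) (m : ℝ → ℝ) (x : Coord) : Fin 4 → ℝ :=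
  ![Real.sqrt (kerrDelta a m (x 1) / kerrSigma a x),
    Real.sqrt (kerrSigma a x / kerrDelta a m (x 1)), Real.sqrt (kerrSigma a x),
    Real.sin (x 2) / Real.sqrt (kerrSigma a x)]

theorem kerrCotetrad_eq :
    kerrCotetrad a m x =
      Matrix.diagonal (cotetradScale a m x) * unnormalizedCotetrad a x := by
  ext i j
  rw [Matrix.diagonal_mul]
  fin_cases i <;> fin_cases j <;> simp [kerrCotetrad, cotetradScale, unnormalizedCotetrad]

/-- Moving the scale factors onto `N` makes the square roots occur only in products of two, where
they simplify. -/
theorem transpose_cotetrad_mul_mul (N : Mat4) :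
    (kerrCotetrad a m x)ᵀ * N * kerrCotetrad a m x =
      (unnormalizedCotetrad a x)ᵀ *
        (Matrix.of fun i j => cotetradScale a m x i * N i j * cotetradScale a m x j) *
        unnormalizedCotetrad a x := by
  rw [kerrCotetrad_eq, Matrix.transpose_mul, Matrix.diagonal_transpose]
  have : (Matrix.of fun i j => cotetradScale a m x i * N i j * cotetradScale a m x j) =
      Matrix.diagonal (cotetradScale a m x) * N * Matrix.diagonal (cotetradScale a m x) := by
    ext i j
    rw [Matrix.mul_diagonal, Matrix.diagonal_mul, Matrix.of_apply]
  rw [this]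
  simp only [Matrix.mul_assoc]

theorem transpose_cotetrad_mul_diagonal_mul (hx : x ∈ kerrRegion a m I)
    (hD : 0 < kerrDelta a m (x 1)) (n : Fin 4 → ℝ) :
    (kerrCotetrad a m x)ᵀ * Matrix.diagonal n * kerrCotetrad a m x =
      (unnormalizedCotetrad a x)ᵀ *
        Matrix.diagonal ![kerrDelta a m (x 1) / kerrSigma a x * n 0,
          kerrSigma a x / kerrDelta a m (x 1) * n 1, kerrSigma a x * n 2,
          Real.sin (x 2) ^ 2 / kerrSigma a x * n 3] * unnormalizedCotetrad a x := by
  have hS := kerrSigma_pos hx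
  rw [transpose_cotetrad_mul_mul]
  congr 2
  ext i j
  have h1 := Real.sq_sqrt (div_pos hD hS).le
  have h2 := Real.sq_sqrt (div_pos hS hD).le
  have h3 := Real.sq_sqrt hS.le
  fin_cases i <;> fin_cases j <;> simp [cotetradScale]
  · linear_combination n 0 * h1
  · linear_combination n 1 * h2
  · linear_combination n 2 * h3
  · field_simp
    rw [h3]
    ring

theorem transpose_cotetrad_mul_minkowski_mul (hx : x ∈ kerrRegion a m I)
    (hD : 0 < kerrDelta a m (x 1)) :
    (kerrCotetrad a m x)ᵀ * minkowski * kerrCotetrad a m x = kerrMetric a m x := by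
  rw [minkowski, transpose_cotetrad_mul_diagonal_mul hx hD]
  ext i j
  fin_cases i <;> fin_cases j <;>
    simp [Matrix.mul_apply, Fin.sum_univ_four, unnormalizedCotetrad, kerrMetric] <;> ring

theorem transpose_cotetrad_mul_radial_mul (hx : x ∈ kerrRegion a m I)
    (hD : 0 < kerrDelta a m (x 1)) :
    (kerrCotetrad a m x)ᵀ * Matrix.diagonal ![-1, 1, 0, 0] * kerrCotetrad a m x =
      radialForm.map (eval (kerrEnv a m x)) := by
  rw [transpose_cotetrad_mul_diagonal_mul hx hD]
  ext i j
  fin_cases i <;> fin_cases j <;>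
    simp [Matrix.mul_apply, Fin.sum_univ_four, unnormalizedCotetrad, radialForm, sigma,
      kerrEnv, kerrSigma] <;> ring

/-- The middle matrix carries lowered tetrad indices, so its `(t, r)` block has the opposite sign to
that of `f^{μ̂ν̂}`. Its entries pair `t` with `r` and `θ` with `φ`, exactly the products of scale
factors that are free of roots. -/
theorem transpose_cotetrad_mul_yano_mul (hx : x ∈ kerrRegion a m I)
    (hD : 0 < kerrDelta a m (x 1)) :
    (kerrCotetrad a m x)ᵀ * !![0, -(a * Real.cos (x 2)), 0, 0; a * Real.cos (x 2), 0, 0, 0;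
      0, 0, 0, -(x 1); 0, 0, x 1, 0] * kerrCotetrad a m x = kerrYano a x := by
  have hS := kerrSigma_pos hx
  have h1 : Real.sqrt (kerrDelta a m (x 1) / kerrSigma a x) *
      Real.sqrt (kerrSigma a x / kerrDelta a m (x 1)) = 1 := by
    rw [← Real.sqrt_mul (div_pos hD hS).le, div_mul_div_cancel₀ hS.ne', div_self hD.ne',
      Real.sqrt_one]
  have h2 : Real.sqrt (kerrSigma a x) * (Real.sin (x 2) / Real.sqrt (kerrSigma a x)) =
      Real.sin (x 2) := mul_div_cancel₀ _ (Real.sqrt_pos.2 hS).ne'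
  have h : (Matrix.of fun i j => cotetradScale a m x i *
      (!![0, -(a * Real.cos (x 2)), 0, 0; a * Real.cos (x 2), 0, 0, 0;
        0, 0, 0, -(x 1); 0, 0, x 1, 0] : Mat4) i j * cotetradScale a m x j) =
      !![0, -(a * Real.cos (x 2)), 0, 0; a * Real.cos (x 2), 0, 0, 0;
        0, 0, 0, -(x 1 * Real.sin (x 2)); 0, 0, x 1 * Real.sin (x 2), 0] := by
    ext i j
    fin_cases i <;> fin_cases j <;> simp [cotetradScale]
    · linear_combination a * Real.cos (x 2) * h1
    · linear_combination a * Real.cos (x 2) * h1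
    · linear_combination x 1 * h2
    · linear_combination x 1 * h2
  rw [transpose_cotetrad_mul_mul, h]
  have hc2 := Real.cos_sq' (x 2)
  ext i j
  fin_cases i <;> fin_cases j <;>
    simp [Matrix.mul_apply, Fin.sum_univ_four, unnormalizedCotetrad, kerrYano] <;> ring

theorem minkowski_mul_self : minkowski * minkowski = 1 := by
  rw [minkowski, Matrix.diagonal_mul_diagonal, ← Matrix.diagonal_one]
  congr 1
  ext i
  fin_cases i <;> simp

theorem cotetrad_mul_inv_mul_transpose (hx : x ∈ kerrRegion a m I)
    (hD : 0 < kerrDelta a m (x 1)) :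
    kerrCotetrad a m x * (kerrMetric a m x)⁻¹ * (kerrCotetrad a m x)ᵀ = minkowski := by
  have h := Matrix.nonsing_inv_mul _ (isUnit_det_kerrMetric hx)
  nth_rw 2 [← transpose_cotetrad_mul_minkowski_mul hx hD] at h
  -- With `e` the co-tetrad, `g⁻¹ eᵀ η` is a left inverse of `e`, hence a right inverse; multiplying
  -- by `η` on the right gives the claim.
  rw [← Matrix.mul_assoc, mul_eq_one_comm] at h
  calc _ = (kerrCotetrad a m x * ((kerrMetric a m x)⁻¹ * ((kerrCotetrad a m x)ᵀ * minkowski)))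
        * minkowski := by
        simp only [Matrix.mul_assoc, minkowski_mul_self, Matrix.mul_one]
    _ = minkowski := by rw [h, Matrix.one_mul]

/-- A covariant expansion in the co-tetrad yields the contravariant tetrad components by conjugation
with `η`; the dual frame is never needed. -/
theorem tetradComponents_raiseIdx (hx : x ∈ kerrRegion a m I)
    (hD : 0 < kerrDelta a m (x 1)) {T : Coord → Mat4} {N : Mat4}
    (hT : T x = (kerrCotetrad a m x)ᵀ * N * kerrCotetrad a m x) :
    tetradComponents a m (raiseIdx (kerrMetric a m) T) x = minkowski * N * minkowski := by
  have h := cotetrad_mul_inv_mul_transpose hx hD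
  rw [tetradComponents, raiseIdx, hT, ← h]
  simp only [Matrix.mul_assoc]

theorem raiseIdx_lowerIdx (hx : x ∈ kerrRegion a m I) (T : Coord → Mat4) :
    raiseIdx (kerrMetric a m) (lowerIdx (kerrMetric a m) T) x = T x := by
  have hu := isUnit_det_kerrMetric hx
  rw [raiseIdx, lowerIdx, Matrix.mul_assoc, Matrix.mul_assoc, Matrix.mul_nonsing_inv _ hu,
    Matrix.mul_one, ← Matrix.mul_assoc, Matrix.nonsing_inv_mul _ hu, Matrix.one_mul]

/-! ## The Killing tower -/

theorem kerrKillingUp_eq (hx : x ∈ kerrRegion a m I) :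
    kerrKillingUp a m x = killingUp.map (eval (kerrEnv a m x)) := by
  have hs := (sin_pos_of_mem_kerrRegion hx).ne'
  have hS : kerrSigma a x ≠ 0 := hx.2.2
  have hD := hx.1.2
  ext i j
  fin_cases i <;> fin_cases j <;>
    simp [kerrKillingUp, killingUp, kerrEnv, rho, -mul_eq_mul_left_iff,
      -mul_eq_mul_right_iff] <;>
    field_simp <;> ring

theorem lowerIdx_kerrKillingUp (hx : x ∈ kerrRegion a m I) :
    lowerIdx (kerrMetric a m) (kerrKillingUp a m) x =
      killing.map (eval (kerrEnv a m x)) := by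
  rw [lowerIdx, kerrMetric_eq hx, kerrKillingUp_eq hx,
    metric_mul_killingUp_mul_metric (kerrEnv_valid hx)]

theorem killing_map_eq (hx : x ∈ kerrRegion a m I) :
    killing.map (eval (kerrEnv a m x)) =
      kerrSigma a x • radialForm.map (eval (kerrEnv a m x)) - x 1 ^ 2 • kerrMetric a m x := by
  rw [kerrMetric_eq hx]
  rfl

theorem kerrKillingPK_eq (hx : x ∈ kerrRegion a m I) :
    kerrKillingUp a m x = -(kerrKillingPK a m x
      + !![a ^ 2, 0, 0, a; 0, 0, 0, 0; 0, 0, 0, 0; a, 0, 0, 0]) := by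
  have hs := (sin_pos_of_mem_kerrRegion hx).ne'
  have hS : x 1 ^ 2 + a ^ 2 * Real.cos (x 2) ^ 2 ≠ 0 := hx.2.2
  have hD := hx.1.2
  -- The mass function occurs only through `2 r m`, which is traded for `Δ`.
  have hm : 2 * x 1 * m (x 1) = x 1 ^ 2 + a ^ 2 - kerrDelta a m (x 1) := by
    rw [kerrDelta]
    ring
  have h1 : 2 * x 1 * (x 1 ^ 2 + a ^ 2) * m (x 1) =
      (x 1 ^ 2 + a ^ 2) * (x 1 ^ 2 + a ^ 2 - kerrDelta a m (x 1)) := by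
    linear_combination (x 1 ^ 2 + a ^ 2) * hm
  have h2 : 2 * a * x 1 * m (x 1) = a * (x 1 ^ 2 + a ^ 2 - kerrDelta a m (x 1)) := by
    linear_combination a * hm
  have hc2 := Real.cos_sq' (x 2)
  ext i j
  fin_cases i <;> fin_cases j <;>
    simp [kerrKillingUp, kerrKillingPK, h1, h2, kerrSigma, -mul_eq_mul_left_iff,
      -mul_eq_mul_right_iff] <;>
    field_simp <;> (try simp only [hc2]) <;> ring

theorem lowerIdx_kerrKillingPK (hx : x ∈ kerrRegion a m I) :
    lowerIdx (kerrMetric a m) (kerrKillingPK a m) x =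
      killingPK.map (eval (kerrEnv a m x)) := by
  have h : kerrKillingPK a m x = -kerrKillingUp a m x
      - !![a ^ 2, 0, 0, a; 0, 0, 0, 0; 0, 0, 0, 0; a, 0, 0, 0] := by
    rw [kerrKillingPK_eq hx]
    abel
  have hK : kerrMetric a m x * kerrKillingUp a m x * kerrMetric a m x = _ :=
    lowerIdx_kerrKillingUp hx
  rw [lowerIdx, h, mul_sub, sub_mul, mul_neg, neg_mul, hK]
  have hg : ∀ i, kerrMetric a m x i 0 = (metric 0 i).eval (kerrEnv a m x) := fun i =>
    (congrFun (congrFun (transpose_kerrMetric x) 0) i).trans (kerrMetric_apply hx 0 i)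
  have hg' : ∀ i, kerrMetric a m x i 3 = (metric 3 i).eval (kerrEnv a m x) := fun i =>
    (congrFun (congrFun (transpose_kerrMetric x) 3) i).trans (kerrMetric_apply hx 3 i)
  ext i j
  simp only [Matrix.sub_apply, Matrix.neg_apply, Matrix.map_apply, killingPK, Matrix.of_apply,
    eval_sub, eval_neg, eval_add, eval_mul, eval_pow, eval_a, Matrix.mul_apply,
    Fin.sum_univ_four, hg, hg', kerrMetric_apply hx 0 j, kerrMetric_apply hx 3 j]
  simp [kerrEnv]
  ring

theorem kerrYano_eq (x : Coord) : kerrYano a x = yano.map (eval (kerrEnv a m x)) := by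
  ext i j
  fin_cases i <;> fin_cases j <;> simp [kerrYano, yano, kerrEnv, rho]

theorem kerrYanoUp_eq (hx : x ∈ kerrRegion a m I) :
    kerrYanoUp a m x = yanoUp.map (eval (kerrEnv a m x)) := by
  rw [kerrYanoUp, raiseIdx, inv_kerrMetric_eq hx, kerrYano_eq (m := m),
    inverseMetric_mul_yano_mul_inverseMetric (kerrEnv_valid hx)]

/-- The density `Σ sin θ` cancels the inverse factors in `f^{μν}`, so `h` is polynomial and
independent of `Δ`. -/
theorem kerrPrincipal_eq (hx : x ∈ kerrRegion a m I) :
    kerrPrincipal a m x = principal.map (eval (kerrEnv a m x)) := by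
  have hs := sin_pos_of_mem_kerrRegion hx
  have hS := kerrSigma_pos hx
  have hdet : Real.sqrt |(kerrMetric a m x).det| = kerrSigma a x * Real.sin (x 2) := by
    rw [det_kerrMetric hx, abs_neg, abs_of_nonneg (sq_nonneg _),
      Real.sqrt_sq (mul_pos hS hs).le]
  have h := leviCivita_contract (kerrYanoUp a m x)
  have hF := kerrYanoUp_eq hx
  have e : kerrPrincipal a m x = (1 / 2 * (kerrSigma a x * Real.sin (x 2))) •
      (Matrix.of fun μ ν => ∑ α, ∑ β, leviCivita μ ν α β * kerrYanoUp a m x α β) := by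
    ext i j
    simp only [kerrPrincipal, hodgeDual, hdet, Matrix.of_apply, Matrix.smul_apply, smul_eq_mul]
    rfl
  rw [e, h, hF]
  have hs' := hs.ne'
  have hS' := hS.ne'
  ext i j
  fin_cases i <;> fin_cases j <;>
    simp [yanoUp, principal, kerrEnv, rho, -mul_eq_mul_left_iff, -mul_eq_mul_right_iff] <;>
    field_simp <;> ring

theorem isKillingTensor_of_eq_eval (hI : IsOpen I) (hm : ContDiffOn ℝ 2 m I)
    {T : Coord → Mat4} {F : Matrix (Fin 4) (Fin 4) KerrExpr}
    (hT : ∀ y ∈ kerrRegion a m I, T y = F.map (eval (kerrEnv a m y)))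
    (hsymm : ∀ i j p, (F i j).eval p = (F j i).eval p)
    (hF : ∀ (D₂ : ℝ) {p : KerrEnv}, p.Valid → ∀ μ ν α,
      evalCov D₂ p F α μ ν + evalCov D₂ p F μ ν α + evalCov D₂ p F ν α μ = 0) :
    IsKillingTensor (kerrMetric a m) (kerrRegion a m I) T where
  contDiffOn i j := contDiffOn_of_eq_eval hI hm (e := F i j) fun y hy => by
    rw [hT y hy, Matrix.map_apply]
  symm y hy i j := by
    rw [hT y hy, Matrix.map_apply, Matrix.map_apply, hsymm]
  killing y hy μ ν α := by
    simp only [covDeriv_kerrMetric hI hm hT hy]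
    exact hF _ (kerrEnv_valid hy) μ ν α

theorem eval_killing_symm (i j : Fin 4) (p : KerrEnv) :
    (killing i j).eval p = (killing j i).eval p := by
  fin_cases i <;> fin_cases j <;> rfl

theorem eval_killingPK_symm (i j : Fin 4) (p : KerrEnv) :
    (killingPK i j).eval p = (killingPK j i).eval p := by
  simp only [killingPK, Matrix.of_apply, eval_sub, eval_neg, eval_add, eval_mul, eval_pow,
    eval_killing_symm i j]
  ring

theorem isKillingTensor_kerrKillingUp (hI : IsOpen I) (hm : ContDiffOn ℝ 2 m I) :
    IsKillingTensor (kerrMetric a m) (kerrRegion a m I)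
      (lowerIdx (kerrMetric a m) (kerrKillingUp a m)) :=
  isKillingTensor_of_eq_eval hI hm (fun _ => lowerIdx_kerrKillingUp) eval_killing_symm
    fun D₂ _ => evalCov_killing D₂

theorem isKillingTensor_kerrKillingPK (hI : IsOpen I) (hm : ContDiffOn ℝ 2 m I) :
    IsKillingTensor (kerrMetric a m) (kerrRegion a m I)
      (lowerIdx (kerrMetric a m) (kerrKillingPK a m)) :=
  isKillingTensor_of_eq_eval hI hm (fun _ => lowerIdx_kerrKillingPK) eval_killingPK_symm
    fun D₂ _ => evalCov_killingPK D₂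

theorem spatialLeviCivita_add_swap (α μ ν : Fin 4) :
    spatialLeviCivita α μ ν + spatialLeviCivita ν μ α = 0 := by
  fin_cases α <;> fin_cases μ <;> fin_cases ν <;> simp [spatialLeviCivita]

theorem isKillingYano_kerrYano (hI : IsOpen I) (hm : ContDiffOn ℝ 2 m I) :
    IsKillingYano (kerrMetric a m) (kerrRegion a m I) (kerrYano a) where
  contDiffOn i j := contDiffOn_of_eq_eval hI hm (e := yano i j) fun y _ => by
    rw [kerrYano_eq (m := m), Matrix.map_apply]
  antisymm y _ i j := by fin_cases i <;> fin_cases j <;> simp [kerrYano]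
  killingYano y hy μ ν α := by
    have h : ∀ α μ ν, covDeriv (kerrMetric a m) (kerrYano a) y α μ ν = _ := fun α μ ν =>
      (covDeriv_kerrMetric hI hm (fun z _ => kerrYano_eq z) hy α μ ν).trans
        (evalCov_yano _ (kerrEnv_valid hy) α μ ν)
    rw [h, h, ← mul_add, spatialLeviCivita_add_swap, mul_zero]

/-- Both sides are `g⁻¹ (f g⁻¹ f) g⁻¹`, and the middle factor is the lowered `K`. -/
theorem yano_square (hx : x ∈ kerrRegion a m I) :
    kerrKillingUp a m x = kerrYanoUp a m x * kerrMetric a m x * kerrYanoUp a m x := by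
  have hu := isUnit_det_kerrMetric hx
  have h : kerrYano a x * (kerrMetric a m x)⁻¹ * kerrYano a x =
      lowerIdx (kerrMetric a m) (kerrKillingUp a m) x := by
    rw [lowerIdx_kerrKillingUp hx, inv_kerrMetric_eq hx, kerrYano_eq (m := m),
      yano_mul_inverseMetric_mul_yano (kerrEnv_valid hx)]
  rw [← raiseIdx_lowerIdx hx (kerrKillingUp a m), raiseIdx, ← h, kerrYanoUp, raiseIdx]
  simp only [Matrix.mul_assoc]
  rw [Matrix.nonsing_inv_mul_cancel_left _ _ hu]

theorem covDeriv_kerrPrincipal (hI : IsOpen I) (hm : ContDiffOn ℝ 2 m I)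
    (hx : x ∈ kerrRegion a m I) (μ ν α : Fin 4) :
    covDeriv (kerrMetric a m) (kerrPrincipal a m) x μ ν α =
      kerrMetric a m x μ α * kerrMetric a m x 0 ν
        - kerrMetric a m x μ ν * kerrMetric a m x 0 α := by
  rw [covDeriv_kerrMetric hI hm (fun z => kerrPrincipal_eq) hx]
  simp only [kerrMetric_apply hx]
  exact evalCov_principal _ (kerrEnv_valid hx) μ ν α

/-- The constant is `1 - 4`: the first term contracts to `ξ_α`, the second to the dimension times
`ξ_α`. -/
theorem divergence_kerrPrincipal (hI : IsOpen I) (hm : ContDiffOn ℝ 2 m I)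
    (hx : x ∈ kerrRegion a m I) (α : Fin 4) :
    divergence (kerrMetric a m) (kerrPrincipal a m) x α = -3 * kerrMetric a m x 0 α := by
  have h : ∀ i j, ∑ k, (kerrMetric a m x)⁻¹ i k * kerrMetric a m x k j =
      if i = j then 1 else 0 := fun i j => by
    rw [← Matrix.mul_apply, Matrix.nonsing_inv_mul _ (isUnit_det_kerrMetric hx),
      Matrix.one_apply]
  calc divergence (kerrMetric a m) (kerrPrincipal a m) x α
      = ∑ β, (kerrMetric a m x 0 β *
          (∑ γ, (kerrMetric a m x)⁻¹ β γ * kerrMetric a m x γ α)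
        - (∑ γ, (kerrMetric a m x)⁻¹ β γ * kerrMetric a m x γ β) * kerrMetric a m x 0 α) := by
        refine Finset.sum_congr rfl fun β _ => ?_
        rw [Finset.mul_sum, Finset.sum_mul, ← Finset.sum_sub_distrib]
        refine Finset.sum_congr rfl fun γ _ => ?_
        rw [covDeriv_kerrPrincipal hI hm hx]
        ring
    _ = -3 * kerrMetric a m x 0 α := by
        simp [h]
        ring

theorem isClosedConformalKillingYano_kerrPrincipal (hI : IsOpen I) (hm : ContDiffOn ℝ 2 m I) :
    IsClosedConformalKillingYano (kerrMetric a m) (kerrRegion a m I) (kerrPrincipal a m) where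
  contDiffOn i j := contDiffOn_of_eq_eval hI hm (e := principal i j) fun y hy => by
    rw [kerrPrincipal_eq hy, Matrix.map_apply]
  antisymm y hy i j := by
    rw [kerrPrincipal_eq hy]
    fin_cases i <;> fin_cases j <;> simp [principal]
  conformal y hy μ ν α := by
    rw [covDeriv_kerrPrincipal hI hm hy, divergence_kerrPrincipal hI hm hy,
      divergence_kerrPrincipal hI hm hy]
    ring

/-- The determinant is the square of the Pfaffian `A F - B E = a r cos θ sin θ (r² + a² - a²
sin²θ)`, whose last factor is `Σ`. -/
theorem det_kerrPrincipal (hx : x ∈ kerrRegion a m I) :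
    (kerrPrincipal a m x).det =
      (a * x 1 * Real.cos (x 2) * Real.sin (x 2) * kerrSigma a x) ^ 2 := by
  set A := -x 1
  set B := -(a ^ 2 * Real.cos (x 2) * Real.sin (x 2))
  set E := -(a * x 1 * Real.sin (x 2) ^ 2)
  set F := -(a * Real.cos (x 2) * Real.sin (x 2) * (x 1 ^ 2 + a ^ 2))
  have e : kerrPrincipal a m x =
      !![0, A, B, 0; -A, 0, 0, E; -B, -0, 0, F; -0, -E, -F, 0] := by
    rw [kerrPrincipal_eq hx]
    ext i j
    fin_cases i <;> fin_cases j <;> simp [principal, kerrEnv, rho, A, B, E, F]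
  rw [e, Matrix.det_fin_four_antisymm, kerrSigma, Real.cos_sq']
  ring

theorem isPrincipalTensor_kerrPrincipal (hI : IsOpen I) (hm : ContDiffOn ℝ 2 m I) :
    IsPrincipalTensor (kerrMetric a m)
      {x | x ∈ kerrRegion a m I ∧ a * x 1 * Real.cos (x 2) ≠ 0} (kerrPrincipal a m) where
  closedConformal :=
    { contDiffOn := fun i j =>
        ((isClosedConformalKillingYano_kerrPrincipal hI hm).contDiffOn i j).mono fun _ h => h.1
      antisymm := fun y hy =>
        (isClosedConformalKillingYano_kerrPrincipal hI hm).antisymm y hy.1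
      conformal := fun y hy =>
        (isClosedConformalKillingYano_kerrPrincipal hI hm).conformal y hy.1 }
  nondegenerate y hy := by
    rw [det_kerrPrincipal hy.1]
    exact pow_ne_zero _ (mul_ne_zero (mul_ne_zero hy.2 (sin_pos_of_mem_kerrRegion hy.1).ne')
      (kerrSigma_pos hy.1).ne')

/-- The Killing vector products have no `rr` or `θθ` entry. These entries force `c₀ = a² cos²θ` and
`c₀ = -r²`, hence `Σ = 0`. -/
theorem kerrKillingUp_nontrivial (hx : x ∈ kerrRegion a m I) : ¬ ∃ c₀ c₁ c₂ c₃ : ℝ,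
    kerrKillingUp a m x =
      c₀ • (kerrMetric a m x)⁻¹ + !![c₁, 0, 0, c₂; 0, 0, 0, 0; 0, 0, 0, 0; c₂, 0, 0, c₃] := by
  rintro ⟨c₀, c₁, c₂, c₃, h⟩
  have hS := (kerrSigma_pos hx).ne'
  have hD := hx.1.2
  rw [kerrKillingUp_eq hx, inv_kerrMetric_eq hx] at h
  have h1 := congrFun (congrFun h 1) 1
  have h2 := congrFun (congrFun h 2) 2
  simp [killingUp, inverseMetric, kerrEnv] at h1 h2
  apply hS
  rw [kerrSigma]
  field_simp at h1 h2
  linear_combination h1 - h2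

theorem killing_eq_cotetrad (hx : x ∈ kerrRegion a m I) (hD : 0 < kerrDelta a m (x 1)) :
    lowerIdx (kerrMetric a m) (kerrKillingUp a m) x = (kerrCotetrad a m x)ᵀ *
      Matrix.diagonal ![-(a ^ 2 * Real.cos (x 2) ^ 2), a ^ 2 * Real.cos (x 2) ^ 2,
        -(x 1 ^ 2), -(x 1 ^ 2)] * kerrCotetrad a m x := by
  have e : (Matrix.diagonal ![-(a ^ 2 * Real.cos (x 2) ^ 2), a ^ 2 * Real.cos (x 2) ^ 2,
      -(x 1 ^ 2), -(x 1 ^ 2)] : Mat4) =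
      kerrSigma a x • Matrix.diagonal ![-1, 1, 0, 0] - x 1 ^ 2 • minkowski := by
    ext i j
    fin_cases i <;> fin_cases j <;> simp [minkowski, kerrSigma]
  rw [lowerIdx_kerrKillingUp hx, killing_map_eq hx, e, mul_sub, sub_mul, Matrix.mul_smul,
    Matrix.mul_smul, Matrix.smul_mul, Matrix.smul_mul, transpose_cotetrad_mul_radial_mul hx hD,
    transpose_cotetrad_mul_minkowski_mul hx hD]

theorem hasKillingTower (hI : IsOpen I) (hm : ContDiffOn ℝ 2 m I) : HasKillingTower a m I where
  tetrad_orthonormal _ hx hD := transpose_cotetrad_mul_minkowski_mul hx hD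
  killing_tetrad x hx hD := by
    have h := tetradComponents_raiseIdx hx hD (killing_eq_cotetrad hx hD)
    rw [tetradComponents, raiseIdx_lowerIdx hx] at h
    rw [tetradComponents, h, minkowski, Matrix.diagonal_mul_diagonal,
      Matrix.diagonal_mul_diagonal]
    congr 1
    ext i
    fin_cases i <;> simp
  killing := isKillingTensor_kerrKillingUp hI hm
  killing_nontrivial _ := kerrKillingUp_nontrivial
  killingPK := isKillingTensor_kerrKillingPK hI hm
  killingPK_eq _ := kerrKillingPK_eq
  yano_tetrad x hx hD := by
    rw [kerrYanoUp, tetradComponents_raiseIdx hx hD (transpose_cotetrad_mul_yano_mul hx hD).symm]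
    ext i j
    rw [minkowski, Matrix.mul_diagonal, Matrix.diagonal_mul]
    fin_cases i <;> fin_cases j <;> simp
  yano := isKillingYano_kerrYano hI hm
  yano_sq _ := yano_square
  closedConformal := isClosedConformalKillingYano_kerrPrincipal hI hm
  principal := isPrincipalTensor_kerrPrincipal hI hm

/-! ## The Ricci tensor -/

theorem ricci_kerrMetric_eq (hI : IsOpen I) (hm : ContDiffOn ℝ 2 m I)
    (hx : x ∈ kerrRegion a m I) :
    ∃ b c : ℝ, ricci (kerrMetric a m) x =
      b • kerrMetric a m x + c • radialForm.map (eval (kerrEnv a m x)) := by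
  refine ⟨ricciAngular (kerrEnv a m x),
    ricciRadial (deriv (deriv (kerrDelta a m)) (x 1)) (kerrEnv a m x)
      - ricciAngular (kerrEnv a m x), ?_⟩
  ext i j
  rw [ricci_kerrMetric hI hm hx, ricci_algebraic _ (kerrEnv_valid hx), kerrMetric_eq hx]
  rfl

theorem ricciKillingCommute (hI : IsOpen I) (hm : ContDiffOn ℝ 2 m I) :
    RicciKillingCommute a m I where
  commute x hx := by
    obtain ⟨b, c, h⟩ := ricci_kerrMetric_eq hI hm hx
    have hu := isUnit_det_kerrMetric hx
    have hK : kerrKillingUp a m x * kerrMetric a m x =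
        (kerrMetric a m x)⁻¹ * lowerIdx (kerrMetric a m) (kerrKillingUp a m) x := by
      rw [lowerIdx, Matrix.mul_assoc, Matrix.nonsing_inv_mul_cancel_left _ _ hu]
    rw [hK, lowerIdx_kerrKillingUp hx, killing_map_eq hx, h, mul_add, mul_sub,
      Matrix.mul_smul, Matrix.mul_smul, Matrix.mul_smul, Matrix.mul_smul,
      Matrix.nonsing_inv_mul _ hu]
    refine Commute.add_left ?_ ?_ <;> refine Commute.sub_right ?_ ?_ <;>
      refine Commute.smul_left (Commute.smul_right ?_ _) _
    · exact Commute.one_left _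
    · exact Commute.one_left _
    · exact Commute.refl _
    · exact Commute.one_right _
  ricci_diag x hx hD := by
    obtain ⟨b, c, h⟩ := ricci_kerrMetric_eq hI hm hx
    have e : ricci (kerrMetric a m) x = (kerrCotetrad a m x)ᵀ *
        (b • minkowski + c • Matrix.diagonal ![-1, 1, 0, 0]) * kerrCotetrad a m x := by
      rw [h, mul_add, add_mul, Matrix.mul_smul, Matrix.mul_smul, Matrix.smul_mul,
        Matrix.smul_mul, transpose_cotetrad_mul_radial_mul hx hD,
        transpose_cotetrad_mul_minkowski_mul hx hD]
    rw [tetradComponents_raiseIdx hx hD e, minkowski, ← Matrix.diagonal_smul,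
      ← Matrix.diagonal_smul, Matrix.diagonal_add, Matrix.diagonal_mul_diagonal,
      Matrix.diagonal_mul_diagonal]
    exact Matrix.isDiag_diagonal _

/-! ## Separation of variables -/

/-- Off `r = 0`, `θ = π/2` the condition `Σ ≠ 0` is automatic: for `a = 0` and `r = 0` already `Δ =
0`. -/
theorem mem_kerrRegion_of_mem {r θ t φ : ℝ} (hr : r ∈ radialDomain a m I)
    (hθ : θ ∈ Set.Ioo 0 Real.pi) (h : r ≠ 0 ∨ Real.cos θ ≠ 0) :
    (![t, r, θ, φ] : Coord) ∈ kerrRegion a m I := by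
  refine ⟨hr, hθ, ?_⟩
  change r ^ 2 + a ^ 2 * Real.cos θ ^ 2 ≠ 0
  rcases eq_or_ne r 0 with rfl | hr0
  · have ha : a ≠ 0 := by
      rintro rfl
      exact hr.2 (by simp [kerrDelta])
    have hc := h.resolve_left (by simp)
    positivity
  · positivity

theorem exists_ne_mem_of_isOpen {U : Set ℝ} (hU : IsOpen U) (hne : U.Nonempty) (c : ℝ) :
    ∃ r ∈ U, r ≠ c := by
  obtain ⟨r, hr, hc⟩ := (dense_compl_singleton c).inter_open_nonempty U hU hne
  exact ⟨r, hr, hc⟩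

theorem cos_ne_zero_of_ne {θ : ℝ} (hθ : θ ∈ Set.Ioo 0 Real.pi) (h : θ ≠ Real.pi / 2) :
    Real.cos θ ≠ 0 := by
  intro hc
  refine h (Real.injOn_cos ⟨hθ.1.le, hθ.2.le⟩ ⟨by positivity, by linarith [Real.pi_pos]⟩ ?_)
  rw [hc, Real.cos_pi_div_two]

/-- The factor `Σ` in `√-g` cancels that in `g⁻¹`. After division by `sin θ`, each entry is a
function of `r` plus a function of `θ`. -/
theorem inverse_weight (hx : x ∈ kerrRegion a m I) (i j : Fin 4) :
    Real.sqrt (-(kerrMetric a m x).det) * (kerrMetric a m x)⁻¹ i j =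
      (!![-(Real.sin (x 2) * ((x 1 ^ 2 + a ^ 2) ^ 2 / kerrDelta a m (x 1)
            - a ^ 2 * Real.sin (x 2) ^ 2)), 0, 0,
          -(a * Real.sin (x 2) * ((x 1 ^ 2 + a ^ 2) / kerrDelta a m (x 1) - 1));
        0, Real.sin (x 2) * kerrDelta a m (x 1), 0, 0;
        0, 0, Real.sin (x 2), 0;
        -(a * Real.sin (x 2) * ((x 1 ^ 2 + a ^ 2) / kerrDelta a m (x 1) - 1)), 0, 0,
          1 / Real.sin (x 2) - a ^ 2 * Real.sin (x 2) / kerrDelta a m (x 1)] : Mat4) i j := by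
  have hs := sin_pos_of_mem_kerrRegion hx
  have hS := kerrSigma_pos hx
  rw [det_kerrMetric hx, neg_neg, Real.sqrt_sq (mul_pos hS hs).le, inv_kerrMetric_eq hx]
  have hs' := hs.ne'
  have hS' := hS.ne'
  have hD := hx.1.2
  have hSc : kerrSigma a x = x 1 ^ 2 + a ^ 2 * Real.cos (x 2) ^ 2 := rfl
  have hc2 := Real.cos_sq' (x 2)
  fin_cases i <;> fin_cases j <;>
    simp [inverseMetric, kerrEnv, massTerm, rho, -mul_eq_mul_left_iff,
      -mul_eq_mul_right_iff] <;>
    (field_simp; try simp only [hSc, hc2]) <;> ring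

section mode

variable (ω k : ℂ) (R S : ℝ → ℂ)

theorem pderiv_t_mul_separatedMode {w : Coord → ℂ}
    (hw : ∀ s : ℝ, w (Function.update x 0 s) = w x) :
    pderiv 0 (fun y => w y * separatedMode ω k R S y) x =
      w x * (-(Complex.I * ω) * separatedMode ω k R S x) := by
  have h : HasDerivAt (fun s : ℝ => Complex.exp (-(Complex.I * ω * (s : ℂ))))
      (Complex.exp (-(Complex.I * ω * (x 0 : ℂ))) * -(Complex.I * ω * 1)) (x 0) :=
    ((Complex.ofRealCLM.hasDerivAt.const_mul (Complex.I * ω)).neg).cexp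
  simp only [pderiv, hw, separatedMode, Function.update_self, Function.update_of_ne, ne_eq,
    Fin.reduceEq, not_false_eq_true]
  refine ((((h.mul_const _).mul_const _).mul_const _).const_mul _).deriv.trans ?_
  ring

theorem pderiv_φ_mul_separatedMode {w : Coord → ℂ}
    (hw : ∀ s : ℝ, w (Function.update x 3 s) = w x) :
    pderiv 3 (fun y => w y * separatedMode ω k R S y) x =
      w x * (Complex.I * k * separatedMode ω k R S x) := by
  have h : HasDerivAt (fun s : ℝ => Complex.exp (Complex.I * k * (s : ℂ)))
      (Complex.exp (Complex.I * k * (x 3 : ℂ)) * (Complex.I * k * 1)) (x 3) :=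
    (Complex.ofRealCLM.hasDerivAt.const_mul (Complex.I * k)).cexp
  simp only [pderiv, hw, separatedMode, Function.update_self, Function.update_of_ne, ne_eq,
    Fin.reduceEq, not_false_eq_true]
  refine ((((h.const_mul _).mul_const _).mul_const _).const_mul _).deriv.trans ?_
  ring

theorem pderiv_t_separatedMode :
    pderiv 0 (separatedMode ω k R S) x = -(Complex.I * ω) * separatedMode ω k R S x := by
  simpa using pderiv_t_mul_separatedMode (x := x) ω k R S (w := fun _ => 1) fun _ => rfl

theorem pderiv_φ_separatedMode :
    pderiv 3 (separatedMode ω k R S) x = Complex.I * k * separatedMode ω k R S x := by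
  simpa using pderiv_φ_mul_separatedMode (x := x) ω k R S (w := fun _ => 1) fun _ => rfl

/-- True for arbitrary `R`, since `deriv` commutes with constant factors from a field even where it
takes its default value `0`. -/
theorem pderiv_r_separatedMode :
    pderiv 1 (separatedMode ω k R S) x = separatedMode ω k (deriv R) S x := by
  simp [pderiv, separatedMode, mul_assoc]

theorem pderiv_θ_separatedMode :
    pderiv 2 (separatedMode ω k R S) x = separatedMode ω k R (deriv S) x := by
  simp [pderiv, separatedMode, mul_assoc]

end mode

/-- The `r`-dependent part of the Klein–Gordon operator. -/
def radialOp (a : ℝ) (m : ℝ → ℝ) (μ : ℝ) (ω k : ℂ) (R : ℝ → ℂ) (r : ℝ) : ℂ :=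
  deriv (fun s : ℝ => (kerrDelta a m s : ℂ) * deriv R s) r
    + ((((r ^ 2 + a ^ 2 : ℝ) : ℂ) * ω - (a : ℂ) * k) ^ 2 / (kerrDelta a m r : ℂ)
        - ((μ ^ 2 * r ^ 2 : ℝ) : ℂ)) * R r

/-- The `θ`-dependent part of the Klein–Gordon operator. -/
def angularOp (a μ : ℝ) (ω k : ℂ) (S : ℝ → ℂ) (θ : ℝ) : ℂ :=
  deriv (fun s : ℝ => (Real.sin s : ℂ) * deriv S s) θ / (Real.sin θ : ℂ)
    + (-((a : ℂ) * ω * (Real.sin θ : ℂ) - k / (Real.sin θ : ℂ)) ^ 2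
        - ((μ ^ 2 * a ^ 2 * Real.cos θ ^ 2 : ℝ) : ℂ)) * S θ

theorem waveOp_separatedMode (hI : IsOpen I) (hm : ContinuousOn m I)
    (hx : x ∈ kerrRegion a m I) (μ : ℝ) (ω k : ℂ) (R S : ℝ → ℂ) :
    (kerrSigma a x : ℂ) * (waveOp (kerrMetric a m) (separatedMode ω k R S) x
        - ((μ ^ 2 : ℝ) : ℂ) * separatedMode ω k R S x) =
      Complex.exp (-(Complex.I * ω * (x 0 : ℂ))) * Complex.exp (Complex.I * k * (x 3 : ℂ)) *
        (radialOp a m μ ω k R (x 1) * S (x 2) + R (x 1) * angularOp a μ ω k S (x 2)) := by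
  have hU := isOpen_kerrRegion (a := a) hI hm
  set wtt : Coord → ℝ := fun y => -(Real.sin (y 2) * ((y 1 ^ 2 + a ^ 2) ^ 2 /
    kerrDelta a m (y 1) - a ^ 2 * Real.sin (y 2) ^ 2)) with htt
  set wtφ : Coord → ℝ := fun y => -(a * Real.sin (y 2) * ((y 1 ^ 2 + a ^ 2) /
    kerrDelta a m (y 1) - 1)) with htφ
  set wφφ : Coord → ℝ := fun y => 1 / Real.sin (y 2) - a ^ 2 * Real.sin (y 2) /
    kerrDelta a m (y 1) with hφφ
  have h0 : pderiv 0 (fun y => ∑ β, (Real.sqrt (-(kerrMetric a m y).det) *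
      (kerrMetric a m y)⁻¹ 0 β) • pderiv β (separatedMode ω k R S) y) x =
      (-(Complex.I * ω) * wtt x + Complex.I * k * wtφ x) *
        (-(Complex.I * ω) * separatedMode ω k R S x) := by
    rw [← pderiv_t_mul_separatedMode ω k R S
      (w := fun y => -(Complex.I * ω) * wtt y + Complex.I * k * wtφ y)
      fun s => by simp [htt, htφ]]
    refine pderiv_congr_of_isOpen hU (fun y hy => ?_) hx 0
    simp only [Fin.sum_univ_four, inverse_weight hy, pderiv_t_separatedMode,
      pderiv_φ_separatedMode, Complex.real_smul]
    simp [htt, htφ]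
    ring
  have h3 : pderiv 3 (fun y => ∑ β, (Real.sqrt (-(kerrMetric a m y).det) *
      (kerrMetric a m y)⁻¹ 3 β) • pderiv β (separatedMode ω k R S) y) x =
      (-(Complex.I * ω) * wtφ x + Complex.I * k * wφφ x) *
        (Complex.I * k * separatedMode ω k R S x) := by
    rw [← pderiv_φ_mul_separatedMode ω k R S
      (w := fun y => -(Complex.I * ω) * wtφ y + Complex.I * k * wφφ y)
      fun s => by simp [hφφ, htφ]]
    refine pderiv_congr_of_isOpen hU (fun y hy => ?_) hx 3
    simp only [Fin.sum_univ_four, inverse_weight hy, pderiv_t_separatedMode,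
      pderiv_φ_separatedMode, Complex.real_smul]
    simp [hφφ, htφ]
    ring
  -- The radial flux is again a separated mode, with factors `Δ R'` and `sin θ S`, so the
  -- first-derivative formula applies a second time.
  have h1 : pderiv 1 (fun y => ∑ β, (Real.sqrt (-(kerrMetric a m y).det) *
      (kerrMetric a m y)⁻¹ 1 β) • pderiv β (separatedMode ω k R S) y) x =
      separatedMode ω k (deriv fun s : ℝ => (kerrDelta a m s : ℂ) * deriv R s)
        (fun θ => (Real.sin θ : ℂ) * S θ) x := by
    rw [← pderiv_r_separatedMode]
    refine pderiv_congr_of_isOpen hU (fun y hy => ?_) hx 1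
    simp only [Fin.sum_univ_four, inverse_weight hy, pderiv_r_separatedMode,
      Complex.real_smul]
    simp [separatedMode]
    ring
  have h2 : pderiv 2 (fun y => ∑ β, (Real.sqrt (-(kerrMetric a m y).det) *
      (kerrMetric a m y)⁻¹ 2 β) • pderiv β (separatedMode ω k R S) y) x =
      separatedMode ω k R (deriv fun s : ℝ => (Real.sin s : ℂ) * deriv S s) x := by
    rw [← pderiv_θ_separatedMode]
    refine pderiv_congr_of_isOpen hU (fun y hy => ?_) hx 2
    simp only [Fin.sum_univ_four, inverse_weight hy, pderiv_θ_separatedMode,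
      Complex.real_smul]
    simp [separatedMode]
    ring
  have hs := sin_pos_of_mem_kerrRegion hx
  have hS := kerrSigma_pos hx
  have hs' : (Real.sin (x 2) : ℂ) ≠ 0 := by exact_mod_cast hs.ne'
  have hS' : (kerrSigma a x : ℂ) ≠ 0 := by exact_mod_cast hS.ne'
  have hD' : (kerrDelta a m (x 1) : ℂ) ≠ 0 := by exact_mod_cast hx.1.2
  have hSc : (kerrSigma a x : ℂ) = (x 1 : ℂ) ^ 2 + (a : ℂ) ^ 2 * (Real.cos (x 2) : ℂ) ^ 2 := by
    exact_mod_cast rfl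
  have hI2 : Complex.I ^ 2 = -1 := Complex.I_sq
  rw [waveOp, Fin.sum_univ_four, h0, h1, h2, h3, det_kerrMetric hx, neg_neg,
    Real.sqrt_sq (mul_pos hS hs).le, Complex.real_smul]
  simp only [separatedMode, radialOp, angularOp, htt, htφ, hφφ]
  generalize deriv (fun s : ℝ => (kerrDelta a m s : ℂ) * deriv R s) (x 1) = R2
  generalize deriv (fun s : ℝ => (Real.sin s : ℂ) * deriv S s) (x 2) = S2
  push_cast [-Complex.ofReal_sin, -Complex.ofReal_cos]
  generalize Complex.exp (-(Complex.I * ω * (x 0 : ℂ))) = e1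
  generalize Complex.exp (Complex.I * k * (x 3 : ℂ)) = e2
  generalize (Real.sin (x 2) : ℂ) = s at *
  generalize (kerrDelta a m (x 1) : ℂ) = D at *
  generalize (Real.cos (x 2) : ℂ) = c at *
  generalize (kerrSigma a x : ℂ) = Q at *
  field_simp
  simp only [hI2, hSc]
  ring

theorem kleinGordonSeparates (hI : IsOpen I) (hm : ContinuousOn m I) :
    KleinGordonSeparates a m I := by
  intro μ ω k R S hR hS ⟨x₀, hx₀, hne⟩
  have hrad : ∀ Λ, RadialEquation a m I μ ω k Λ R ↔
      ∀ r ∈ radialDomain a m I, radialOp a m μ ω k R r = Λ * R r := fun Λ => by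
    refine forall₂_congr fun r _ => ?_
    rw [← sub_eq_zero (a := radialOp a m μ ω k R r), radialOp]
    ring_nf
  have hang : ∀ Λ, AngularEquation a μ ω k Λ S ↔
      ∀ θ ∈ Set.Ioo 0 Real.pi, angularOp a μ ω k S θ = -Λ * S θ := fun Λ => by
    refine forall₂_congr fun θ _ => ?_
    rw [← sub_eq_zero (a := angularOp a μ ω k S θ), angularOp]
    ring_nf
  have hpde : ∀ x ∈ kerrRegion a m I,
      (waveOp (kerrMetric a m) (separatedMode ω k R S) x =
          ((μ ^ 2 : ℝ) : ℂ) * separatedMode ω k R S x ↔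
        radialOp a m μ ω k R (x 1) * S (x 2) + R (x 1) * angularOp a μ ω k S (x 2) = 0) := by
    intro x hx
    have h := waveOp_separatedMode hI hm hx μ ω k R S
    have hS' : (kerrSigma a x : ℂ) ≠ 0 := by exact_mod_cast (kerrSigma_pos hx).ne'
    rw [← sub_eq_zero, ← mul_eq_zero_iff_left hS', h]
    exact mul_eq_zero_iff_left (mul_ne_zero (Complex.exp_ne_zero _) (Complex.exp_ne_zero _))
  rw [forall₂_congr hpde]
  constructor
  · intro h
    have hR₀ : R (x₀ 1) ≠ 0 := fun h0 => hne (by simp [separatedMode, h0])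
    have hS₀ : S (x₀ 2) ≠ 0 := fun h0 => hne (by simp [separatedMode, h0])
    -- By continuity `R ≠ 0` on a nonempty open set, which contains some `r₀ ≠ 0`. Likewise `S θ₀ ≠
    -- 0` for some `θ₀ ≠ π/2`. Then `r₀` pairs with every `θ`, and `θ₀` with every `r`.
    obtain ⟨r₀, ⟨hr₀, hRr₀⟩, hr₀0⟩ := exists_ne_mem_of_isOpen
      (hR.continuousOn.isOpen_inter_preimage (isOpen_radialDomain hI hm)
        (isOpen_compl_singleton (x := (0 : ℂ)))) ⟨x₀ 1, hx₀.1, hR₀⟩ 0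
    obtain ⟨θ₀, ⟨hθ₀, hSθ₀⟩, hθ₀0⟩ := exists_ne_mem_of_isOpen
      (hS.continuousOn.isOpen_inter_preimage isOpen_Ioo
        (isOpen_compl_singleton (x := (0 : ℂ)))) ⟨x₀ 2, hx₀.2.1, hS₀⟩ (Real.pi / 2)
    replace hRr₀ : R r₀ ≠ 0 := hRr₀
    replace hSθ₀ : S θ₀ ≠ 0 := hSθ₀
    have hc₀ := cos_ne_zero_of_ne hθ₀ hθ₀0
    have key : ∀ r ∈ radialDomain a m I, ∀ θ ∈ Set.Ioo 0 Real.pi, (r ≠ 0 ∨ Real.cos θ ≠ 0) →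
        radialOp a m μ ω k R r * S θ + R r * angularOp a μ ω k S θ = 0 :=
      fun r hr θ hθ h0 => h ![0, r, θ, 0] (mem_kerrRegion_of_mem hr hθ h0)
    have k₀ := key r₀ hr₀ θ₀ hθ₀ (Or.inl hr₀0)
    refine ⟨radialOp a m μ ω k R r₀ / R r₀, (hrad _).2 fun r hr => ?_,
      (hang _).2 fun θ hθ => ?_⟩
    · have k₁ := key r hr θ₀ hθ₀ (Or.inr hc₀)
      rw [div_mul_eq_mul_div, eq_div_iff hRr₀]
      -- Eliminating the angular operator at `θ₀` between `r` and `r₀` leaves the radial equation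
      -- times `S θ₀`.
      refine mul_right_cancel₀ hSθ₀ ?_
      linear_combination R r₀ * k₁ - R r * k₀
    · have k₁ := key r₀ hr₀ θ hθ (Or.inl hr₀0)
      rw [← neg_div, div_mul_eq_mul_div, eq_div_iff hRr₀]
      linear_combination k₁
  · rintro ⟨Λ, h1, h2⟩ x hx
    rw [(hrad Λ).1 h1 _ hx.1, (hang Λ).1 h2 _ hx.2.1]
    ring

/-- The factor `Σ` separates `g^{αβ} p_α p_β` into an `r` part and a `θ` part; the mass term `μ² Σ`
splits in the same way. -/
theorem hamiltonJacobi_sum (hx : x ∈ kerrRegion a m I) (E L : ℝ) (W V : ℝ → ℝ) :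
    kerrSigma a x * ∑ α, ∑ β, (kerrMetric a m x)⁻¹ α β
        * pderiv α (fun y => -E * y 0 + L * y 3 + W (y 1) + V (y 2)) x
        * pderiv β (fun y => -E * y 0 + L * y 3 + W (y 1) + V (y 2)) x =
      kerrDelta a m (x 1) * deriv W (x 1) ^ 2
          - ((x 1 ^ 2 + a ^ 2) * E - a * L) ^ 2 / kerrDelta a m (x 1)
        + (deriv V (x 2) ^ 2 + (a * E * Real.sin (x 2) - L / Real.sin (x 2)) ^ 2) := by
  set F : Coord → ℝ := fun y => -E * y 0 + L * y 3 + W (y 1) + V (y 2) with hF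
  have h0 : pderiv 0 F x = -E := by simp [pderiv, hF]
  have h1 : pderiv 1 F x = deriv W (x 1) := by simp [pderiv, hF]
  have h2 : pderiv 2 F x = deriv V (x 2) := by simp [pderiv, hF]
  have h3 : pderiv 3 F x = L := by simp [pderiv, hF]
  have hs' := (sin_pos_of_mem_kerrRegion hx).ne'
  have hS' := (kerrSigma_pos hx).ne'
  have hD := hx.1.2
  have hSc : kerrSigma a x = x 1 ^ 2 + a ^ 2 * Real.cos (x 2) ^ 2 := rfl
  have hc2 := Real.cos_sq' (x 2)
  simp [Fin.sum_univ_four, h0, h1, h2, h3, inv_kerrMetric_eq hx, inverseMetric, kerrEnv,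
    massTerm, rho]
  field_simp
  simp only [hSc, hc2]
  ring

theorem hamiltonJacobiSeparates (hI : IsOpen I) (hm : ContinuousOn m I) :
    HamiltonJacobiSeparates a m I := by
  intro ⟨x₀, hx₀⟩ μ E L W V _ _
  set A : ℝ → ℝ := fun r => kerrDelta a m r * deriv W r ^ 2
    - ((r ^ 2 + a ^ 2) * E - a * L) ^ 2 / kerrDelta a m r + μ ^ 2 * r ^ 2 with hA
  set B : ℝ → ℝ := fun θ => deriv V θ ^ 2 + (a * E * Real.sin θ - L / Real.sin θ) ^ 2
    + μ ^ 2 * a ^ 2 * Real.cos θ ^ 2 with hB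
  have hpde : ∀ x ∈ kerrRegion a m I, ((∑ α, ∑ β, (kerrMetric a m x)⁻¹ α β
        * pderiv α (fun y => -E * y 0 + L * y 3 + W (y 1) + V (y 2)) x
        * pderiv β (fun y => -E * y 0 + L * y 3 + W (y 1) + V (y 2)) x = -μ ^ 2) ↔
      A (x 1) + B (x 2) = 0) := by
    intro x hx
    have h := hamiltonJacobi_sum hx E L W V
    have hSc : kerrSigma a x = x 1 ^ 2 + a ^ 2 * Real.cos (x 2) ^ 2 := rfl
    rw [← mul_right_inj' (kerrSigma_pos hx).ne', h, ← sub_eq_zero, hSc]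
    simp only [hA, hB]
    ring_nf
  rw [forall₂_congr hpde]
  constructor
  · intro h
    have key : ∀ r ∈ radialDomain a m I, ∀ θ ∈ Set.Ioo 0 Real.pi, (r ≠ 0 ∨ Real.cos θ ≠ 0) →
        A r + B θ = 0 :=
      fun r hr θ hθ h0 => h ![0, r, θ, 0] (mem_kerrRegion_of_mem hr hθ h0)
    obtain ⟨r₀, hr₀, hr₀0⟩ :=
      exists_ne_mem_of_isOpen (isOpen_radialDomain hI hm) ⟨x₀ 1, hx₀.1⟩ 0
    obtain ⟨θ₀, hθ₀, hθ₀0⟩ :=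
      exists_ne_mem_of_isOpen isOpen_Ioo ⟨x₀ 2, hx₀.2.1⟩ (Real.pi / 2)
    have k₀ := key r₀ hr₀ θ₀ hθ₀ (Or.inl hr₀0)
    -- `A r + B θ₀ = 0` for every `r`, and comparison at `r₀` gives `B θ = B θ₀` for every `θ`.
    refine ⟨B θ₀, fun r hr => ?_, fun θ hθ => ?_⟩
    · linear_combination key r hr θ₀ hθ₀ (Or.inr (cos_ne_zero_of_ne hθ₀ hθ₀0))
    · linear_combination key r₀ hr₀ θ hθ (Or.inl hr₀0) - k₀
  · rintro ⟨C, h1, h2⟩ x hx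
    linear_combination h1 _ hx.1 + h2 _ hx.2.1

theorem contDiffOn_eosMass (M ℓ : ℝ) : ContDiffOn ℝ 2 (eosMass M ℓ) (Set.Ioi 0) := by
  unfold eosMass
  exact contDiffOn_const.mul
    ((contDiffOn_const.div contDiffOn_id fun r hr => (ne_of_gt hr)).exp)

end

theorem mainTheorem4 (a : ℝ) :
    (∀ (m : ℝ → ℝ) (I : Set ℝ), IsOpen I → ContDiffOn ℝ 2 m I →
      HasKillingTower a m I ∧ RicciKillingCommute a m I ∧
        KleinGordonSeparates a m I ∧ HamiltonJacobiSeparates a m I) ∧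
    (∀ M ℓ : ℝ,
      HasKillingTower a (eosMass M ℓ) (Set.Ioi 0) ∧ RicciKillingCommute a (eosMass M ℓ) (Set.Ioi 0) ∧
        KleinGordonSeparates a (eosMass M ℓ) (Set.Ioi 0) ∧
        HamiltonJacobiSeparates a (eosMass M ℓ) (Set.Ioi 0)) :=
  ⟨fun _ _ hI hm => ⟨hasKillingTower hI hm, ricciKillingCommute hI hm,
      kleinGordonSeparates hI hm.continuousOn, hamiltonJacobiSeparates hI hm.continuousOn⟩,
    fun M ℓ =>
      have hI := isOpen_Ioi
      have hm := contDiffOn_eosMass M ℓ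
      ⟨hasKillingTower hI hm, ricciKillingCommute hI hm,
        kleinGordonSeparates hI hm.continuousOn, hamiltonJacobiSeparates hI hm.continuousOn⟩⟩
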